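/- Let $\mathbb{K}$ be a field with $|\mathbb{K}|>2$, and let $d,v\in\mathbb{N}\cup\{\infty\}$ with $d\ge 1$, $v\geq 0$ (dimensions are projective; all spaces may be infinite-dimensional). An \emph{ovoid} of a projective space $W$ is a point set $O$ spanning $W$ such that for each $x\in O$ the union of the lines of $W$ meeting $O$ exactly in $x$ is a hyperplane of $W$, and every other line of $W$ through $x$ meets $O$ in exactly one further point. Let $\xi$ be a projective space spanned by a $v$-space $V$ and a $(d+1)$-space $W$ with $V\cap W=\emptyset$, and let $O$ be an ovoid of $W$. The union of the subspaces $\langle V,o\rangle$, $o\in O$, is a $(d,v)$-\emph{cone} in $\xi$ with vertex $V$; the cone minus $V$ is a $(d,v)$-\emph{tube} in $\xi$ with vertex $V$. Let $X$ be a spanning point set of a projective space over $\mathbb{K}$ and $\Xi$ a family of proper $(d+v+2)$-dimensional subspaces such that for every $\xi\in\Xi$ the set $X\cap\xi$ is a $(d,v)$-tube in $\xi$, with vertex denoted $V_\xi$. Let $\mathcal{C}=\{X\cap\xi\mid\xi\in\Xi\}$ be the set of tubes, and let $Y=\bigcup_{\xi\in\Xi}V_\xi$. Suppose that $(X,\Xi)$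 is a Hjelmslevean Veronese set, i.e. (H1) any two distinct points of $X$ lie in a common member of $\Xi$; (H2$^*$) for distinct $\xi_1,\xi_2\in\Xi$ we have $\xi_1\cap\xi_2=\big((X\cap\xi_1)\cup V_{\xi_1}\big)\cap\big((X\cap\xi_2)\cup V_{\xi_2}\big)$, and $\xi_1\cap\xi_2\cap X\neq\emptyset$; and that it is vertex-reduced: any two vertices $V_\xi,V_{\xi'}$ coincide or are disjoint, and not all vertices coincide. For $x\in X$ let $\overline{\Pi}_x$ be the largest subspace $A\ni x$ with $A\subseteq X\cup Y$ for which $A\cap Y$ is a hyperplane of $A$, and let $\Pi_x^Y=\overline{\Pi}_x\cap Y$. Let $\mathbb{P}_Y^*$ be the incidence structure whose points are the sets $\Pi^Y_x$, $x\in X$, whose lines are the vertices $V_\xi$, $\xi\in\Xi$, a line $V$ being incident with a point $\Pi$ if $V\subseteq\Pi$. Let $\overline\chi$ map $x\in X$ to $\Pi_x^Y$ and a tube $C\in\mathcal{C}$ to its vertex. Then $(X,\mathcal{C})$ is a projective Hjelmslev plane of level 2: any two points are on a common tube, any two tubes share a point, and there is an epimorphism (an incidence-preserving map, surjective on points and on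 lines) onto a projective plane such that two points (resp. two tubes) have the same image if and only if they are not incident with a unique tube (resp. point). More precisely, $\mathbb{P}_Y^*$ is a projective plane, $\overline\chi$ is an epimorphism from $(X,\mathcal{C})$ to $\mathbb{P}_Y^*$, for each tube $C$ the set $\{\overline\chi(x)\mid x\in C\}$ is exactly the set of points of $\mathbb{P}_Y^*$ on the line $\overline\chi(C)$, and (Hj1) two points $x,x'\in X$ are always joined by at least one member of $\mathcal{C}$; this member is unique if and only if $\overline\chi(x)\ne\overline\chi(x')$; (Hj2) two members $C,C'$ of $\mathcal{C}$ always intersect in at least one point; this point is unique if and only if $\overline\chi(C)\neq\overline\chi(C')$; (Hj3) for each point $p$ of $\mathbb{P}_Y^*$, the inverse image of $p$ in $X$, endowed with its nonempty intersections with tubes as lines, is an affine plane; (Hj4) for each line $l$ of $\mathbb{P}_Y^*$, the set of tubes all of whose points are mapped by $\overline\chi$ to points on $l$ (these tubes being the points), endowed with the intersections of two distinct such tubes (these being the lines, an intersection being incident with every such tube containing it), is an affine plane. -/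

import Mathlib

open scoped LinearAlgebra.Projectivization

/-! ### Incidence structures -/

/-- The incidence relation `I` between points `P` and lines `L` is that of a projective plane. -/
def IsProjectivePlane {P L : Type*} (I : P → L → Prop) : Prop :=
  Nonempty (@Configuration.ProjectivePlane P L ⟨fun l p => I p l⟩)

/-- The incidence relation `I` between points `P` and lines `L` is that of an affine plane. -/
structure IsAffinePlane {P L : Type*} (I : P → L → Prop) : Prop where
  existsUnique_line : ∀ p q : P, p ≠ q → ∃! l : L, I p l ∧ I q l
  existsUnique_parallel : ∀ (p : P) (l : L), ¬ I p l → ∃! m : L, I p m ∧ ∀ q : P, ¬ (I q l ∧ I q m)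
  exists_triangle : ∃ p q r : P, ∀ l : L, ¬ (I p l ∧ I q l ∧ I r l)

/-- `f` (on points) and `g` (on lines) form an epimorphism of incidence structures. -/
structure IsIncidenceEpimorphism {P L P' L' : Type*} (I : P → L → Prop) (J : P' → L' → Prop)
    (f : P → P') (g : L → L') : Prop where
  map_inc : ∀ (p : P) (l : L), I p l → J (f p) (g l)
  surjective_points : Function.Surjective f
  surjective_lines : Function.Surjective g

universe u w

/-- Projective Hjelmslev planes of level 2: any two points are joined, any two lines meet, and
there is an epimorphism to a projective plane identifying two points (two lines) exactly when they
are not incident with a unique line (point). -/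
def IsProjectiveHjelmslevPlaneLevelTwo {P : Type u} {L : Type w} (I : P → L → Prop) : Prop :=
  (∀ p q : P, ∃ l : L, I p l ∧ I q l) ∧
  (∀ l m : L, ∃ p : P, I p l ∧ I p m) ∧
  ∃ (P' : Type u) (L' : Type w) (J : P' → L' → Prop) (f : P → P') (g : L → L'),
    IsProjectivePlane J ∧ IsIncidenceEpimorphism I J f g ∧
    (∀ p q : P, f p = f q ↔ ¬ ∃! l : L, I p l ∧ I q l) ∧
    (∀ l m : L, g l = g m ↔ ¬ ∃! p : P, I p l ∧ I p m)

namespace HVeronese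

variable {K E : Type*} [Field K] [AddCommGroup E] [Module K E]

variable (K E) in
/-- The subspaces of the projective space of lines through the origin of `E`. -/
abbrev PSub : Type _ := Projectivization.Subspace K E

/-! ### Ovoids and tubes -/

/-- The subspace `S` has projective dimension `n`, where `n = ⊤` stands for infinite dimension. -/
def HasDim (S : PSub K E) (n : ℕ∞) : Prop :=
  Cardinal.toENat (Module.rank K (Projectivization.Subspace.submodule S)) = n + 1

/-- `O` is an ovoid of the projective space `W`: it spans `W`, for every `x ∈ O` the union of the
lines of `W` meeting `O` exactly in `x` is a hyperplane of `W`, and every other line of `W`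
through `x` meets `O` in exactly one further point. -/
structure IsOvoid (W : PSub K E) (O : Set (ℙ K E)) : Prop where
  span_eq : Projectivization.Subspace.span O = W
  tangent : ∀ x ∈ O, ∃ T : PSub K E, T ⋖ W ∧
    (T : Set (ℙ K E)) = {p | ∃ L : PSub K E, HasDim L 1 ∧ L ≤ W ∧ p ∈ L ∧ (L : Set (ℙ K E)) ∩ O = {x}}
  secant : ∀ x ∈ O, ∀ L : PSub K E, HasDim L 1 → L ≤ W → x ∈ L →
    (L : Set (ℙ K E)) ∩ O ≠ {x} → ∃! y, y ∈ O ∧ y ∈ L ∧ y ≠ x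

/-- The cone with vertex `V` and base `O`: the union of the generators `⟨V, o⟩`, `o ∈ O`. For
nonempty `V` it is the union of the lines joining a point of `V` to a point of `O`. -/
def cone (V : PSub K E) (O : Set (ℙ K E)) : Set (ℙ K E) :=
  {p | ∃ o ∈ O, p ∈ V ⊔ Projectivization.Subspace.span {o}}

/-- `C` is a `(d, v)`-tube with vertex `V` in the `(d + v + 2)`-dimensional space `ξ`: for some
`(d + 1)`-space `W` complementary in `ξ` to the `v`-space `V` and some ovoid `O` of `W`, it is the
cone with vertex `V` and base `O`, with its vertex removed. -/
def IsTube (d v : ℕ∞) (ξ V : PSub K E) (C : Set (ℙ K E)) : Prop :=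
  HasDim V v ∧ ∃ (W : PSub K E) (O : Set (ℙ K E)),
    HasDim W (d + 1) ∧ Disjoint V W ∧ V ⊔ W = ξ ∧ IsOvoid W O ∧ C = cone V O \ V

/-! ### Hjelmslevean Veronese sets -/

variable (K E) in
/-- A spanning point set `X` together with a family `Ξ` of proper subspaces (the tubic spaces),
each of which meets `X` in a `(d, v)`-tube. For finite `d`, `v`, properness of the
`(d + v + 2)`-dimensional tubic spaces says that the ambient dimension exceeds `d + v + 2`. -/
structure TubicSet (d v : ℕ∞) where
  /-- The points. -/
  X : Set (ℙ K E)
  /-- The tubic spaces. -/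
  Ξ : Set (PSub K E)
  span_X : Projectivization.Subspace.span X = ⊤
  ne_top : ∀ ξ ∈ Ξ, ξ ≠ ⊤
  exists_tube : ∀ ξ ∈ Ξ, ∃ V : PSub K E, IsTube d v ξ V (X ∩ ξ)

namespace TubicSet

variable {d v : ℕ∞} (S : TubicSet K E d v)

/-- The vertex of the tube `X ∩ ξ` (the tube determines it as soon as `K` has more than two
elements). -/
noncomputable def vertex (ξ : S.Ξ) : PSub K E :=
  (S.exists_tube ξ ξ.2).choose

/-- The union of all vertices. -/
def Y : Set (ℙ K E) :=
  {y | ∃ ξ : S.Ξ, y ∈ S.vertex ξ}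

/-- The cone containing the tube `X ∩ ξ`: the tube together with its vertex. -/
def tubeCone (ξ : S.Ξ) : Set (ℙ K E) :=
  (S.X ∩ (ξ : PSub K E)) ∪ S.vertex ξ

/-- The two axioms of Hjelmslevean Veronese sets. -/
structure IsHjelmslevean : Prop where
  /-- Two distinct points lie in a common tubic space. -/
  h1 : ∀ x ∈ S.X, ∀ y ∈ S.X, x ≠ y → ∃ ξ : S.Ξ, x ∈ (ξ : PSub K E) ∧ y ∈ (ξ : PSub K E)
  /-- Two distinct tubic spaces meet in points of their cones only ... -/
  h2 : ∀ ξ ξ' : S.Ξ, ξ ≠ ξ' →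
    ((ξ : PSub K E) : Set (ℙ K E)) ∩ (ξ' : PSub K E) = S.tubeCone ξ ∩ S.tubeCone ξ'
  /-- ... and share a point of `X`. -/
  h2' : ∀ ξ ξ' : S.Ξ, ξ ≠ ξ' →
    (((ξ : PSub K E) : Set (ℙ K E)) ∩ (ξ' : PSub K E) ∩ S.X).Nonempty

/-- Any two vertices coincide or are disjoint, and not all vertices coincide. -/
def VertexReduced : Prop :=
  (∀ ξ ξ' : S.Ξ, S.vertex ξ = S.vertex ξ' ∨ Disjoint (S.vertex ξ) (S.vertex ξ')) ∧
  ∃ ξ ξ' : S.Ξ, Disjoint (S.vertex ξ) (S.vertex ξ')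

/-! ### The geometry of points and tubes -/

/-- The tubes `X ∩ ξ`, as sets of points. -/
def Tube : Type _ := {C : Set (ℙ K E) // ∃ ξ : S.Ξ, C = S.X ∩ (ξ : PSub K E)}

/-- The tubic space of a tube. -/
noncomputable def tubicSpace (C : S.Tube) : S.Ξ := C.2.choose

/-- Incidence of points of `X` with tubes. -/
def Inc (x : S.X) (C : S.Tube) : Prop := (x : ℙ K E) ∈ C.1

/-! ### The dual plane of vertices -/

/-- `A` is the projective completion of a singular affine subspace: all its points are in `X ∪ Y`
(so any two of them are on a line contained in `X ∪ Y`), and those in `Y` form a hyperplane. -/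
def IsSingularAffine (A : PSub K E) : Prop :=
  (A : Set (ℙ K E)) ⊆ S.X ∪ S.Y ∧
  ∃ H : PSub K E, H ⋖ A ∧ (H : Set (ℙ K E)) = (A : Set (ℙ K E)) ∩ S.Y

/-- The projective completion of the maximal singular affine subspace `Π_x` through `x ∈ X`
(the supremum of all singular affine subspaces through `x`, which is the largest one). -/
def piBar (x : ℙ K E) : PSub K E :=
  sSup {A | S.IsSingularAffine A ∧ x ∈ A}

/-- The subspace at infinity `Π_x^Y` of `Π_x`, as a set of points. -/
def piY (x : ℙ K E) : Set (ℙ K E) :=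
  (S.piBar x : Set (ℙ K E)) ∩ S.Y

/-- The points of the dual plane of vertices: the sets `Π_x^Y`. -/
def DualPoint : Type _ := {p : Set (ℙ K E) // ∃ x : S.X, p = S.piY x}

/-- The lines of the dual plane of vertices: the vertices of the tubes, as sets of points. -/
def DualLine : Type _ := {l : Set (ℙ K E) // ∃ ξ : S.Ξ, l = S.vertex ξ}

/-- Incidence in the dual plane of vertices: the vertex is contained in `Π_x^Y`. -/
def DualInc (p : S.DualPoint) (l : S.DualLine) : Prop := l.1 ⊆ p.1

/-- The map `x ↦ Π_x^Y`. -/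
def chi (x : S.X) : S.DualPoint := ⟨S.piY x, x, rfl⟩

/-- The induced map on tubes, taking a tube to its vertex. -/
noncomputable def chiLine (C : S.Tube) : S.DualLine :=
  ⟨S.vertex (S.tubicSpace C), S.tubicSpace C, rfl⟩

/-! ### The affine planes -/

/-- The points of `X` mapped to the point `p` of the dual plane. -/
def pointFibre (p : S.DualPoint) : Set (ℙ K E) :=
  {x | ∃ h : x ∈ S.X, S.chi ⟨x, h⟩ = p}

/-- The nonempty intersections of the fibre over `p` with tubes. -/
def FibreLine (p : S.DualPoint) : Type _ :=
  {l : Set (ℙ K E) // l.Nonempty ∧ ∃ C : S.Tube, l = S.pointFibre p ∩ C.1}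

/-- Incidence of points of the fibre over `p` with the nonempty traces of tubes on it. -/
def FibreInc (p : S.DualPoint) (x : S.pointFibre p) (l : S.FibreLine p) : Prop :=
  (x : ℙ K E) ∈ l.1

/-- The inverse image of a line `l` of the dual plane: the points of `X` mapped to points of the
dual plane on `l`. -/
def linePreimage (l : S.DualLine) : Set (ℙ K E) :=
  {x | ∃ h : x ∈ S.X, S.DualInc (S.chi ⟨x, h⟩) l}

/-- The tubes contained in the inverse image of the line `l`. -/
def NbhdTube (l : S.DualLine) : Type _ := {C : S.Tube // C.1 ⊆ S.linePreimage l}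

/-- The mutual intersections of distinct tubes contained in the inverse image of the line `l`. -/
def NbhdIntersection (l : S.DualLine) : Type _ :=
  {g : Set (ℙ K E) // ∃ C C' : S.NbhdTube l, C ≠ C' ∧ g = C.1.1 ∩ C'.1.1}

/-- Incidence of the tubes in the inverse image of `l` (in the role of points) with their mutual
intersections (in the role of lines). -/
def NbhdInc (l : S.DualLine) (C : S.NbhdTube l) (g : S.NbhdIntersection l) : Prop :=
  g.1 ⊆ C.1.1

end TubicSet

end HVeronese

/-! ### Vector form of the axioms, and pencils of vertices -/

namespace HVeronese

variable {K E : Type*} [Field K] [AddCommGroup E] [Module K E]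

/-! Everything rests on one fact of linear algebra: the vertices of the tubic spaces through a point
x fill a subspace, the pencil of x. Let y and z be nonzero vectors of two distinct such vertices,
and let k be a scalar other than 0 and 1. The tubic space joining x + y and x + z differs from the
one joining x + k y and x + k z, and both contain the direction y - z. By (H2*) this direction is in
X or in a vertex, so x + y and x + z are on one generator. `not_sub_mem_set` excludes X, and
`exists_add_mem_vertex` and `mem_pencil` follow.

Consequently x and its pencil span the largest singular affine subspace through x (`piBar_eq`), with
the pencil at infinity. Call x' collinear with x if it is a multiple of x plus a vector of the
pencil of x. By (H2*), the pencils of noncollinear points meet exactly in the vertex of a tube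
joining them (`mem_vertex_of_mem_pencils`). Since every pencil contains at least two vertices, equal
pencils mean collinear points (`pencil_eq_iff`), and two points of the dual plane are on only one
line.

The rest is incidence geometry, based on `IsHjelmslevSystem`. Tubes with different vertices meet
once; tubes with the same vertex sharing x share all their points with the image of x. In (Hj3),
parallel lines are traces of tubes with the same vertex; in (Hj4), they are intersections over the
same point of the dual plane. -/

/-- The axioms of a vertex-reduced Hjelmslevean Veronese set in terms of vectors: `X` is the set of
vectors spanning the points, `U i` are the tubic spaces, `V i` their vertices. -/
structure IsTubeSystem {ι : Type*} (X : Set E) (U V : ι → Submodule K E) : Prop where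
  smul_mem_set : ∀ x ∈ X, ∀ c : K, c ≠ 0 → c • x ∈ X
  vertex_le : ∀ i, V i ≤ U i
  vertex_ne_bot : ∀ i, V i ≠ ⊥
  notMem_vertex : ∀ x ∈ X, ∀ i, x ∉ V i
  add_mem_set : ∀ i, ∀ x ∈ X, x ∈ U i → ∀ y ∈ V i, x + y ∈ X
  generator : ∀ i, ∀ a ∈ X, a ∈ U i → ∀ b ∈ X, b ∈ U i → (a + b ∈ X ∨ a + b ∈ V i) →
    ∃ c : K, b - c • a ∈ V i
  exists_three : ∀ i, ∃ a ∈ X, ∃ b ∈ X, ∃ c ∈ X, a ∈ U i ∧ b ∈ U i ∧ c ∈ U i ∧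
    ∀ k : K, b - k • a ∉ V i ∧ c - k • a ∉ V i ∧ c - k • b ∉ V i
  joined : ∀ a ∈ X, ∀ b ∈ X, ∃ i, a ∈ U i ∧ b ∈ U i
  meet : ∀ i j, i ≠ j → ∃ x ∈ X, x ∈ U i ∧ x ∈ U j
  inter : ∀ i j, i ≠ j → ∀ z ∈ U i, z ∈ U j → z ≠ 0 → z ∈ X ∨ z ∈ V i
  reduced : ∀ i j, ∀ y ∈ V i, y ∈ V j → y ≠ 0 → V i = V j
  exists_ne : ∃ i j, V i ≠ V j

namespace IsTubeSystem

variable {ι : Type*} {X : Set E} {U V : ι → Submodule K E}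

/-- The span of the vertices of the tubic spaces through `x`. -/
def pencil (U V : ι → Submodule K E) (x : E) : Submodule K E := ⨆ (i) (_ : x ∈ U i), V i

theorem le_pencil {x : E} {i : ι} (hx : x ∈ U i) : V i ≤ pencil U V x :=
  le_iSup₂_of_le i hx le_rfl

theorem ne_zero (h : IsTubeSystem X U V) {x : E} (hx : x ∈ X) : x ≠ 0 := by
  rintro rfl
  obtain ⟨i, -⟩ := h.joined _ hx _ hx
  exact h.notMem_vertex _ hx i (zero_mem _)

theorem sub_mem_set (h : IsTubeSystem X U V) {i : ι} {x y : E} (hx : x ∈ X) (hxi : x ∈ U i)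
    (hy : y ∈ V i) : x - y ∈ X := by
  rw [sub_eq_add_neg]
  exact h.add_mem_set i x hx hxi _ (neg_mem hy)

/-- Vectors of a vertex are never in X, so (H2*) leaves only `V i`. To place such a vector in
another vertex it thus suffices to place it in the tubic space. -/
theorem mem_vertex_of_mem (h : IsTubeSystem X U V) {i j : ι} {y : E} (hy : y ∈ V j)
    (hyi : y ∈ U i) : y ∈ V i := by
  by_cases hij : i = j
  · rwa [hij]
  by_cases hy0 : y = 0
  · rw [hy0]; exact zero_mem _
  rcases h.inter i j hij y hyi (h.vertex_le j hy) hy0 with hX | hV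
  · exact absurd hy (h.notMem_vertex y hX j)
  · exact hV

theorem generator_sub (h : IsTubeSystem X U V) {i : ι} {a b : E} (ha : a ∈ X) (hai : a ∈ U i)
    (hb : b ∈ X) (hbi : b ∈ U i) (hab : a - b ∈ X ∨ a - b ∈ V i) : ∃ c : K, b - c • a ∈ V i := by
  have hnb : -b ∈ X := by simpa using h.smul_mem_set b hb (-1) (by simp)
  obtain ⟨c, hc⟩ := h.generator i a ha hai (-b) hnb (neg_mem hbi) (by rwa [← sub_eq_add_neg])
  refine ⟨-c, ?_⟩
  have := neg_mem hc
  rwa [show -(-b - c • a) = b - (-c) • a by module] at this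

/-- Two common points of distinct tubic spaces are on a common generator. -/
theorem exists_sub_smul_mem (h : IsTubeSystem X U V) {i j : ι} (hij : i ≠ j) {a b : E}
    (ha : a ∈ X) (hb : b ∈ X) (hai : a ∈ U i) (haj : a ∈ U j) (hbi : b ∈ U i) (hbj : b ∈ U j) :
    ∃ c : K, b - c • a ∈ V i := by
  apply h.generator i a ha hai b hb hbi
  by_cases h0 : a + b = 0
  · right; rw [h0]; exact zero_mem _
  · exact h.inter i j hij _ (add_mem hai hbi) (add_mem haj hbj) h0

/-- A line joining points of two generators with distinct vertices through `x` is singular. -/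
theorem exists_side_sub_smul_mem (h : IsTubeSystem X U V) {k : K} (hk0 : k ≠ 0) (hk1 : k ≠ 1)
    {x : E} (hx : x ∈ X) {i j : ι} (hxi : x ∈ U i) (hxj : x ∈ U j) (hij : V i ≠ V j)
    {y z : E} (hy : y ∈ V i) (hz : z ∈ V j) (hy0 : y ≠ 0) (hz0 : z ≠ 0) :
    ∃ l, x + y ∈ U l ∧ x + z ∈ U l ∧ ∃ c : K, (x + z) - c • (x + y) ∈ V l := by
  -- The points with y and z scaled by k span a parallel line: both lines have direction y - z.
  have ha := h.add_mem_set i x hx hxi y hy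
  have hb := h.add_mem_set j x hx hxj z hz
  have ha' := h.add_mem_set i x hx hxi (k • y) (Submodule.smul_mem _ _ hy)
  have hb' := h.add_mem_set j x hx hxj (k • z) (Submodule.smul_mem _ _ hz)
  obtain ⟨l, hal, hbl⟩ := h.joined _ ha _ hb
  obtain ⟨m, ham, hbm⟩ := h.joined _ ha' _ hb'
  refine ⟨l, hal, hbl, h.generator_sub ha hal hb hbl ?_⟩
  by_cases hlm : l = m
  · exfalso
    subst hlm
    have hxl : x ∈ U l := by
      have h1 := Submodule.smul_mem _ (k - 1)⁻¹
        (sub_mem (Submodule.smul_mem (U l) k hal) ham)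
      rwa [show k • (x + y) - (x + k • y) = (k - 1) • x by module,
        inv_smul_smul₀ (sub_ne_zero.2 hk1)] at h1
    have hyl : y ∈ V l := h.mem_vertex_of_mem hy ((Submodule.add_mem_iff_right _ hxl).1 hal)
    have hzl : z ∈ V l := h.mem_vertex_of_mem hz ((Submodule.add_mem_iff_right _ hxl).1 hbl)
    exact hij ((h.reduced i l y hy hyl hy0).trans (h.reduced j l z hz hzl hz0).symm)
  · by_cases h0 : (x + y) - (x + z) = 0
    · right; rw [h0]; exact zero_mem _
    · refine h.inter l m hlm _ (sub_mem hal hbl) ?_ h0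
      have h1 := Submodule.smul_mem _ k⁻¹ (sub_mem ham hbm)
      rwa [show (x + k • y) - (x + k • z) = k • ((x + y) - (x + z)) by module,
        inv_smul_smul₀ hk0] at h1

/-- A combination of two points of a generator is a point of the tube or of the vertex. -/
theorem comb_mem (h : IsTubeSystem X U V) {l : ι} {a b : E} (ha : a ∈ X)
    (hal : a ∈ U l) {c : K} (hc : b - c • a ∈ V l) (s t : K) :
    s • a + t • b ∈ X ∨ s • a + t • b ∈ V l := by
  have e : s • a + t • b = (s + t * c) • a + t • (b - c • a) := by module
  have hv : t • (b - c • a) ∈ V l := Submodule.smul_mem _ _ hc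
  by_cases h0 : s + t * c = 0
  · right
    rw [e, h0, zero_smul, zero_add]
    exact hv
  · left
    rw [e]
    exact h.add_mem_set l _ (h.smul_mem_set a ha _ h0) (Submodule.smul_mem _ _ hal) _ hv

/-- The difference of two points of a generator is in `X` or in the vertex. -/
theorem sub_mem_or (h : IsTubeSystem X U V) {l : ι} {a b : E} (ha : a ∈ X) (hal : a ∈ U l)
    {c : K} (hc : b - c • a ∈ V l) : a - b ∈ X ∨ a - b ∈ V l := by
  have := h.comb_mem ha hal hc 1 (-1)
  rwa [show (1 : K) • a + (-1 : K) • b = a - b by module] at this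

/-- If one point of the line yz were in X, a second one would be as well; a tubic space joining them
contains y and z, so its vertex equals both `V i` and `V j`. -/
theorem not_sub_mem_set (h : IsTubeSystem X U V) {k : K} (hk0 : k ≠ 0) (hk1 : k ≠ 1)
    {x : E} (hx : x ∈ X) {i j : ι} (hxi : x ∈ U i) (hxj : x ∈ U j) (hij : V i ≠ V j)
    {y z : E} (hy : y ∈ V i) (hz : z ∈ V j) (hy0 : y ≠ 0) (hz0 : z ≠ 0) : y + z ∉ X := by
  intro hq
  have hk1' : 1 - k ≠ 0 := sub_ne_zero.2 (Ne.symm hk1)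
  -- the line joining `x` and `q = y + z` is singular
  obtain ⟨n, hxn, hqn⟩ := h.joined _ hx _ hq
  have hxq : x + (y + z) ∈ X ∨ x + (y + z) ∈ V n := by
    -- With weights 1 - k and k, the chosen points of the two generators combine to x + (y + z).
    obtain ⟨l, hal, -, c, hc⟩ := h.exists_side_sub_smul_mem hk0 hk1 hx hxi hxj hij
      (Submodule.smul_mem _ (1 - k)⁻¹ hy) (Submodule.smul_mem _ k⁻¹ hz)
      (smul_ne_zero (inv_ne_zero hk1') hy0) (smul_ne_zero (inv_ne_zero hk0) hz0)
    have ha := h.add_mem_set i x hx hxi _ (Submodule.smul_mem _ (1 - k)⁻¹ hy)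
    have h1 := h.comb_mem ha hal hc (1 - k) k
    have e : (1 - k) • (x + (1 - k)⁻¹ • y) + k • (x + k⁻¹ • z) = x + (y + z) := by
      rw [smul_add, smul_add, smul_inv_smul₀ hk1', smul_inv_smul₀ hk0]
      module
    rw [e] at h1
    exact h1.imp_right fun h2 => h.mem_vertex_of_mem h2 (add_mem hxn hqn)
  obtain ⟨d, hd⟩ := h.generator n x hx hxn _ hq hqn hxq
  have hd0 : d ≠ 0 := by
    rintro rfl
    rw [zero_smul, sub_zero] at hd
    exact h.notMem_vertex _ hq _ hd
  -- `u = x + e • (y + z)` is on the vertex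
  obtain ⟨e, he0, hu⟩ : ∃ e : K, e ≠ 0 ∧ x + e • (y + z) ∈ V n := by
    refine ⟨-d⁻¹, neg_ne_zero.2 (inv_ne_zero hd0), ?_⟩
    have h1 := Submodule.smul_mem _ (-d⁻¹) hd
    rwa [smul_sub, neg_smul _ (d • x), inv_smul_smul₀ hd0, sub_neg_eq_add, add_comm] at h1
  -- the point `y + k • z` of the line at infinity is in `X`, too
  have hw : y + k • z ∈ X := by
    -- The coefficients are chosen so that the line through the two new points has direction y + k z
    -- and passes through the vertex point u.
    have hy1 : (e * (1 - k⁻¹)) • y ∈ V i := Submodule.smul_mem _ _ hy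
    have hz1 : (e * (1 - k)) • z ∈ V j := Submodule.smul_mem _ _ hz
    have hki : 1 - k⁻¹ ≠ 0 := sub_ne_zero.2 fun h1 => hk1 (by simpa using h1.symm)
    obtain ⟨l, hal, hbl, c, hc⟩ := h.exists_side_sub_smul_mem hk0 hk1 hx hxi hxj hij hy1 hz1
      (smul_ne_zero (mul_ne_zero he0 hki) hy0) (smul_ne_zero (mul_ne_zero he0 hk1') hz0)
    have ha := h.add_mem_set i x hx hxi _ hy1
    have e1 : (x + (e * (1 - k⁻¹)) • y) - (x + (e * (1 - k)) • z)
        = (e * (1 - k⁻¹)) • (y + k • z) := by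
      have : (e * (1 - k⁻¹)) * k = - (e * (1 - k)) := by field_simp; ring
      rw [smul_add, smul_smul, this]
      module
    have hne : e * (1 - k⁻¹) ≠ 0 := mul_ne_zero he0 hki
    have hdir : (y + k • z) ∈ U l := by
      have h1 := Submodule.smul_mem _ (e * (1 - k⁻¹))⁻¹ (sub_mem hal hbl)
      rwa [e1, inv_smul_smul₀ hne] at h1
    have e2 : x + e • (y + z) = (x + (e * (1 - k⁻¹)) • y) + (e * k⁻¹) • (y + k • z) := by
      have : (e * k⁻¹) * k = e := by field_simp
      rw [smul_add (e * k⁻¹), smul_smul, this]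
      module
    have hul : x + e • (y + z) ∈ V l := by
      refine h.mem_vertex_of_mem hu ?_
      rw [e2]
      exact add_mem hal (Submodule.smul_mem _ _ hdir)
    rcases h.sub_mem_or ha hal hc with h1 | h1
    · rw [e1] at h1
      have h2 := h.smul_mem_set _ h1 _ (inv_ne_zero hne)
      rwa [inv_smul_smul₀ hne] at h2
    · exfalso
      rw [e1] at h1
      have h2 := Submodule.smul_mem _ (e * (1 - k⁻¹))⁻¹ h1
      rw [inv_smul_smul₀ hne] at h2
      have h3 := sub_mem hul (Submodule.smul_mem _ (e * k⁻¹) h2)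
      rw [e2, add_sub_cancel_right] at h3
      exact h.notMem_vertex _ ha _ h3
  obtain ⟨l, hql, hwl⟩ := h.joined _ hq _ hw
  have hzl : z ∈ U l := by
    have h1 := Submodule.smul_mem _ (1 - k)⁻¹ (sub_mem hql hwl)
    rwa [show (y + z) - (y + k • z) = (1 - k) • z by module, inv_smul_smul₀ hk1'] at h1
  have hyl : y ∈ U l := (Submodule.add_mem_iff_left _ hzl).1 hql
  exact hij ((h.reduced i l y hy (h.mem_vertex_of_mem hy hyl) hy0).trans
    (h.reduced j l z hz (h.mem_vertex_of_mem hz hzl) hz0).symm)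

/-- Two points x + y' and x - z' are on one generator, and their difference y' + z' is not in X; so
it is in the vertex. -/
theorem exists_add_mem_vertex (h : IsTubeSystem X U V) {k : K} (hk0 : k ≠ 0) (hk1 : k ≠ 1)
    {x : E} (hx : x ∈ X) {i j : ι} (hxi : x ∈ U i) (hxj : x ∈ U j)
    {y z : E} (hy : y ∈ V i) (hz : z ∈ V j) : ∃ l, x ∈ U l ∧ y + z ∈ V l := by
  by_cases hij : V i = V j
  · exact ⟨i, hxi, add_mem hy (hij ▸ hz)⟩
  by_cases hy0 : y = 0
  · exact ⟨j, hxj, by rwa [hy0, zero_add]⟩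
  by_cases hz0 : z = 0
  · exact ⟨i, hxi, by rwa [hz0, add_zero]⟩
  have hk1' : 1 - k ≠ 0 := sub_ne_zero.2 (Ne.symm hk1)
  have key : ∀ {y' z' : E}, y' ∈ V i → z' ∈ V j → y' ≠ 0 → z' ≠ 0 →
      ∃ l, x + y' ∈ U l ∧ x - z' ∈ U l ∧ y' + z' ∈ V l := by
    intro y' z' hy' hz' hy0' hz0'
    obtain ⟨l, hal, hbl, c, hc⟩ := h.exists_side_sub_smul_mem hk0 hk1 hx hxi hxj hij hy'
      (neg_mem hz') hy0' (neg_ne_zero.2 hz0')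
    refine ⟨l, hal, by rwa [sub_eq_add_neg], ?_⟩
    have e : (x + y') - (x + -z') = y' + z' := by abel
    rcases h.sub_mem_or (h.add_mem_set i x hx hxi _ hy') hal hc with h1 | h1
    · exact absurd (e ▸ h1) (h.not_sub_mem_set hk0 hk1 hx hxi hxj hij hy' hz' hy0' hz0')
    · exact e ▸ h1
  -- For y' = (1 - k)⁻¹ y and z' = -k⁻¹ z, subtracting k (y' + z') from x + y' leaves x + y + z.
  have hxq : x + (y + z) ∈ X := by
    have hy' : (1 - k)⁻¹ • y ∈ V i := Submodule.smul_mem _ _ hy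
    have hz' : (-k⁻¹) • z ∈ V j := Submodule.smul_mem _ _ hz
    obtain ⟨l, hal, -, hv⟩ := key hy' hz' (smul_ne_zero (inv_ne_zero hk1') hy0)
      (smul_ne_zero (neg_ne_zero.2 (inv_ne_zero hk0)) hz0)
    have h1 := h.sub_mem_set (h.add_mem_set i x hx hxi _ hy') hal (Submodule.smul_mem _ k hv)
    convert h1 using 1
    have e : (1 - k)⁻¹ - k * (1 - k)⁻¹ = 1 := by field_simp
    have e' : k * -k⁻¹ = -1 := by field_simp
    calc x + (y + z) = x + ((1 - k)⁻¹ - k * (1 - k)⁻¹) • y - (k * -k⁻¹) • z := by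
          rw [e, e']; module
      _ = _ := by module
  obtain ⟨l, hal, hbl⟩ := h.joined _ hx _ hxq
  obtain ⟨m, -, -, hm⟩ := key hy hz hy0 hz0
  exact ⟨l, hal, h.mem_vertex_of_mem hm ((Submodule.add_mem_iff_right _ hal).1 hbl)⟩

/-- By `exists_add_mem_vertex` the union of the vertices through x is closed under addition, so it
is already their span. -/
theorem mem_pencil (h : IsTubeSystem X U V) {k : K} (hk0 : k ≠ 0) (hk1 : k ≠ 1)
    {x : E} (hx : x ∈ X) {y : E} : y ∈ pencil U V x ↔ ∃ i, x ∈ U i ∧ y ∈ V i := by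
  refine ⟨fun hy => ?_, fun ⟨i, hi, hy⟩ => le_pencil hi hy⟩
  refine Submodule.iSup_induction (motive := fun y => ∃ i, x ∈ U i ∧ y ∈ V i) _ hy ?_ ?_ ?_
  · intro i y hy
    by_cases hi : x ∈ U i
    · rw [iSup_pos hi] at hy
      exact ⟨i, hi, hy⟩
    · rw [iSup_neg hi, Submodule.mem_bot] at hy
      obtain ⟨j, hj, -⟩ := h.joined x hx x hx
      exact ⟨j, hj, hy ▸ zero_mem _⟩
  · obtain ⟨j, hj, -⟩ := h.joined x hx x hx
    exact ⟨j, hj, zero_mem _⟩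
  · rintro y z ⟨i, hi, hy⟩ ⟨j, hj, hz⟩
    exact h.exists_add_mem_vertex hk0 hk1 hx hi hj hy hz

/-- The field has a scalar besides `0` and `1`, so that `mem_pencil` holds. -/
theorem mem_pencil_iff (h : IsTubeSystem X U V) (hK : ∃ k : K, k ≠ 0 ∧ k ≠ 1)
    {x : E} (hx : x ∈ X) {y : E} : y ∈ pencil U V x ↔ ∃ i, x ∈ U i ∧ y ∈ V i :=
  let ⟨_, hk0, hk1⟩ := hK
  h.mem_pencil hk0 hk1 hx

theorem mem_vertex_of_mem_pencil (h : IsTubeSystem X U V) (hK : ∃ k : K, k ≠ 0 ∧ k ≠ 1)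
    {x y : E} (hx : x ∈ X) (hy : y ∈ pencil U V x) {i : ι} (hi : y ∈ U i) : y ∈ V i := by
  obtain ⟨j, -, hj⟩ := (h.mem_pencil_iff hK hx).1 hy
  exact h.mem_vertex_of_mem hj hi

theorem notMem_pencil (h : IsTubeSystem X U V) (hK : ∃ k : K, k ≠ 0 ∧ k ≠ 1)
    {x y : E} (hx : x ∈ X) (hy : y ∈ X) : y ∉ pencil U V x := by
  intro hy'
  obtain ⟨j, -, hj⟩ := (h.mem_pencil_iff hK hx).1 hy'
  exact h.notMem_vertex y hy j hj

theorem add_mem_of_mem_pencil (h : IsTubeSystem X U V) (hK : ∃ k : K, k ≠ 0 ∧ k ≠ 1)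
    {x y : E} (hx : x ∈ X) (hy : y ∈ pencil U V x) : x + y ∈ X := by
  obtain ⟨j, hxj, hj⟩ := (h.mem_pencil_iff hK hx).1 hy
  exact h.add_mem_set j x hx hxj y hj

/-- A tubic space joining x + y to x + y + z contains z, a vector of some vertex, and so has z in
its own vertex. -/
theorem pencil_le_pencil_add (h : IsTubeSystem X U V) (hK : ∃ k : K, k ≠ 0 ∧ k ≠ 1)
    {x y : E} (hx : x ∈ X) (hy : y ∈ pencil U V x) : pencil U V x ≤ pencil U V (x + y) := by
  intro z hz
  have hxy := h.add_mem_of_mem_pencil hK hx hy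
  obtain ⟨i, hi, hi'⟩ := h.joined _ hxy _ (h.add_mem_of_mem_pencil hK hx (add_mem hy hz))
  rw [← add_assoc] at hi'
  exact le_pencil hi (h.mem_vertex_of_mem_pencil hK hx hz ((Submodule.add_mem_iff_right _ hi).1 hi'))

theorem pencil_add (h : IsTubeSystem X U V) (hK : ∃ k : K, k ≠ 0 ∧ k ≠ 1)
    {x y : E} (hx : x ∈ X) (hy : y ∈ pencil U V x) : pencil U V (x + y) = pencil U V x := by
  refine le_antisymm ?_ (h.pencil_le_pencil_add hK hx hy)
  -- Translating back by -y gives the other inclusion.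
  have h1 := h.pencil_le_pencil_add hK (h.add_mem_of_mem_pencil hK hx hy)
    (neg_mem (h.pencil_le_pencil_add hK hx hy hy))
  rwa [add_neg_cancel_right] at h1

theorem pencil_smul {c : K} (hc : c ≠ 0) (x : E) : pencil U V (c • x) = pencil U V x := by
  simp [pencil, Submodule.smul_mem_iff _ hc]

theorem smul_ne_zero_of_sub_mem_pencil (h : IsTubeSystem X U V)
    (hK : ∃ k : K, k ≠ 0 ∧ k ≠ 1) {x x' : E} (hx : x ∈ X) (hx' : x' ∈ X) {c : K}
    (hc : x' - c • x ∈ pencil U V x) : c ≠ 0 := by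
  rintro rfl
  rw [zero_smul, sub_zero] at hc
  exact h.notMem_pencil hK hx hx' hc

theorem pencil_eq_of_sub_mem (h : IsTubeSystem X U V) (hK : ∃ k : K, k ≠ 0 ∧ k ≠ 1)
    {x x' : E} (hx : x ∈ X) (hx' : x' ∈ X) {c : K} (hc : x' - c • x ∈ pencil U V x) :
    pencil U V x' = pencil U V x := by
  have hc0 := h.smul_ne_zero_of_sub_mem_pencil hK hx hx' hc
  rw [← pencil_smul hc0 x] at hc ⊢
  have h1 := h.pencil_add hK (h.smul_mem_set x hx c hc0) hc
  rwa [add_sub_cancel] at h1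

/-- The vertex of the tube through two noncollinear points is the intersection of their pencils. -/
theorem mem_vertex_of_mem_pencils (h : IsTubeSystem X U V) (hK : ∃ k : K, k ≠ 0 ∧ k ≠ 1)
    {x x' : E} (hx : x ∈ X) (hx' : x' ∈ X) (hn : ∀ c : K, x' - c • x ∉ pencil U V x)
    {i : ι} (hi : x ∈ U i) (hi' : x' ∈ U i) {y : E} (hy : y ∈ pencil U V x)
    (hy' : y ∈ pencil U V x') : y ∈ V i := by
  -- The points x + y and x' + y have the same difference as x and x'. If it lay in two distinct
  -- tubic spaces, x and x' would be on one generator.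
  obtain ⟨j, hj, hj'⟩ := h.joined _ (h.add_mem_of_mem_pencil hK hx hy) _
    (h.add_mem_of_mem_pencil hK hx' hy')
  by_cases hij : i = j
  · subst hij
    exact h.mem_vertex_of_mem_pencil hK hx hy ((Submodule.add_mem_iff_right _ hi).1 hj)
  · exfalso
    have hs : x - x' ∈ U j := by
      have := sub_mem hj hj'
      rwa [add_sub_add_right_eq_sub] at this
    have h0 : x - x' ≠ 0 := by
      intro h0
      apply hn 1
      rw [one_smul, ← neg_sub, h0, neg_zero]
      exact zero_mem _
    obtain ⟨c, hc⟩ := h.generator_sub hx hi hx' hi' (h.inter i j hij _ (sub_mem hi hi') hs h0)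
    exact hn c (le_pencil hi hc)

/-- One nonzero vector of `V i` lies in a vertex through x, and reducedness then identifies the two
vertices. -/
theorem exists_vertex_eq (h : IsTubeSystem X U V) (hK : ∃ k : K, k ≠ 0 ∧ k ≠ 1)
    {x : E} (hx : x ∈ X) {i : ι} (hi : V i ≤ pencil U V x) : ∃ j, x ∈ U j ∧ V j = V i := by
  obtain ⟨y, hy, hy0⟩ := (Submodule.ne_bot_iff _).1 (h.vertex_ne_bot i)
  obtain ⟨j, hxj, hj⟩ := (h.mem_pencil_iff hK hx).1 (hi hy)
  exact ⟨j, hxj, h.reduced j i y hj hy hy0⟩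

theorem vertex_eq_of_le (h : IsTubeSystem X U V) {i j : ι} (hij : V i ≤ V j) : V i = V j := by
  obtain ⟨y, hy, hy0⟩ := (Submodule.ne_bot_iff _).1 (h.vertex_ne_bot i)
  exact h.reduced i j y hy (hij hy) hy0

theorem vertex_eq_of_le_pencils (h : IsTubeSystem X U V) (hK : ∃ k : K, k ≠ 0 ∧ k ≠ 1)
    {x x' : E} (hx : x ∈ X) (hx' : x' ∈ X) (hn : ∀ c : K, x' - c • x ∉ pencil U V x)
    {i j : ι} (hi : x ∈ U i) (hi' : x' ∈ U i) (hj : V j ≤ pencil U V x)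
    (hj' : V j ≤ pencil U V x') : V j = V i :=
  h.vertex_eq_of_le fun _ hy => h.mem_vertex_of_mem_pencils hK hx hx' hn hi hi' (hj hy) (hj' hy)

/-- Inside `U i` a vector of the pencil of a point of `U i` is a vector of `V i`, so points on
different generators are noncollinear. -/
theorem exists_noncollinear (h : IsTubeSystem X U V) (hK : ∃ k : K, k ≠ 0 ∧ k ≠ 1) (i : ι) :
    ∃ a ∈ X, ∃ b ∈ X, ∃ c ∈ X, a ∈ U i ∧ b ∈ U i ∧ c ∈ U i ∧
      ∀ k : K, b - k • a ∉ pencil U V a ∧ c - k • a ∉ pencil U V a ∧ c - k • b ∉ pencil U V b := by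
  obtain ⟨a, ha, b, hb, c, hc, hai, hbi, hci, hn⟩ := h.exists_three i
  have key : ∀ {a b : E}, a ∈ X → a ∈ U i → b ∈ U i → ∀ k : K, b - k • a ∉ V i →
      b - k • a ∉ pencil U V a := fun ha hai hbi k hn hp =>
    hn (h.mem_vertex_of_mem_pencil hK ha hp (sub_mem hbi (Submodule.smul_mem _ _ hai)))
  exact ⟨a, ha, b, hb, c, hc, hai, hbi, hci, fun k => ⟨key ha hai hbi k (hn k).1,
    key ha hai hci k (hn k).2.1, key hb hbi hci k (hn k).2.2⟩⟩

/-- Every point is on tubes with distinct vertices. -/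
theorem exists_vertex_ne (h : IsTubeSystem X U V) (hK : ∃ k : K, k ≠ 0 ∧ k ≠ 1)
    {x : E} (hx : x ∈ X) (i : ι) : ∃ j, x ∈ U j ∧ V j ≠ V i := by
  by_contra! hall
  obtain ⟨l, hl⟩ : ∃ l, V l ≠ V i := by
    obtain ⟨l, m, hlm⟩ := h.exists_ne
    by_cases hl : V l = V i
    · exact ⟨m, fun hm => hlm (hl.trans hm.symm)⟩
    · exact ⟨l, hl⟩
  -- Every point is joined to x by a tube, which has vertex `V i` by assumption.
  have hle : ∀ c ∈ X, V i ≤ pencil U V c := by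
    intro c hc
    obtain ⟨j, hxj, hcj⟩ := h.joined x hx c hc
    rw [← hall j hxj]
    exact le_pencil hcj
  obtain ⟨a, ha, b, hb, _, _, hal, hbl, -, hn⟩ := h.exists_noncollinear hK l
  exact hl (h.vertex_eq_of_le_pencils hK ha hb (fun c => (hn c).1) hal hbl (hle a ha)
    (hle b hb)).symm

/-- Pencils of noncollinear points share only one vertex, but every pencil contains at least two. -/
theorem pencil_eq_iff (h : IsTubeSystem X U V) (hK : ∃ k : K, k ≠ 0 ∧ k ≠ 1)
    {x x' : E} (hx : x ∈ X) (hx' : x' ∈ X) :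
    pencil U V x' = pencil U V x ↔ ∃ c : K, x' - c • x ∈ pencil U V x := by
  refine ⟨fun he => ?_, fun ⟨c, hc⟩ => h.pencil_eq_of_sub_mem hK hx hx' hc⟩
  by_contra! hn
  obtain ⟨i, hi, hi'⟩ := h.joined x hx x' hx'
  obtain ⟨j, hj, hji⟩ := h.exists_vertex_ne hK hx i
  exact hji (h.vertex_eq_of_le_pencils hK hx hx' hn hi hi' (le_pencil hj) (he ▸ le_pencil hj))

theorem vertex_eq_of_pencil_ne (h : IsTubeSystem X U V) (hK : ∃ k : K, k ≠ 0 ∧ k ≠ 1)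
    {x x' : E} (hx : x ∈ X) (hx' : x' ∈ X) (hn : pencil U V x' ≠ pencil U V x)
    {i j : ι} (hi : V i ≤ pencil U V x) (hi' : V i ≤ pencil U V x')
    (hj : V j ≤ pencil U V x) (hj' : V j ≤ pencil U V x') : V i = V j := by
  rw [Ne, h.pencil_eq_iff hK hx hx', not_exists] at hn
  obtain ⟨l, hl, hl'⟩ := h.joined x hx x' hx'
  rw [h.vertex_eq_of_le_pencils hK hx hx' hn hl hl' hi hi',
    h.vertex_eq_of_le_pencils hK hx hx' hn hl hl' hj hj']

/-- Every tubic space through `x` is accompanied by another one with the same vertex. -/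
theorem exists_ne_vertex_eq (h : IsTubeSystem X U V) (hK : ∃ k : K, k ≠ 0 ∧ k ≠ 1)
    {x : E} (hx : x ∈ X) {i : ι} (hi : x ∈ U i) : ∃ j, j ≠ i ∧ x ∈ U j ∧ V j = V i := by
  by_contra! hall
  -- The tube joining x to c has vertex `V i`; if `U i` is the only such tubic space through x, it
  -- contains c.
  have key : ∀ c ∈ X, V i ≤ pencil U V c → pencil U V c ≠ pencil U V x → c ∈ U i := by
    intro c hc hle hn
    obtain ⟨j, hxj, hcj⟩ := h.joined x hx c hc
    have hj := h.vertex_eq_of_pencil_ne hK hx hc hn (le_pencil hxj) (le_pencil hcj)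
      (le_pencil hi) hle
    by_contra hci
    exact hall j (fun hji => hci (hji ▸ hcj)) hxj hj
  obtain ⟨c, hc, hci, hn⟩ : ∃ c ∈ X, c ∈ U i ∧ pencil U V c ≠ pencil U V x := by
    obtain ⟨a, ha, b, hb, _, _, hai, hbi, -, hn⟩ := h.exists_noncollinear hK i
    by_cases hax : pencil U V a = pencil U V x
    · refine ⟨b, hb, hbi, ?_⟩
      rw [← hax, Ne, h.pencil_eq_iff hK ha hb, not_exists]
      exact fun k => (hn k).1
    · exact ⟨a, ha, hai, hax⟩
  -- The translates of c by vectors of another vertex have the pencil of c, so by `key` they stay in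
  -- `U i`, which forces that vertex into `V i`.
  obtain ⟨j, hcj, hj⟩ := h.exists_vertex_ne hK hc i
  refine hj (h.vertex_eq_of_le fun y hy => ?_)
  have hyp := le_pencil hcj hy
  refine h.mem_vertex_of_mem_pencil hK hc hyp ((Submodule.add_mem_iff_right _ hci).1 ?_)
  refine key _ (h.add_mem_of_mem_pencil hK hc hyp) ?_ ?_ <;> rw [h.pencil_add hK hc hyp]
  · exact le_pencil hci
  · exact hn

end IsTubeSystem

end HVeronese

/-! ### From ovoids and tubes to the vector axioms -/

namespace HVeronese

variable {K E : Type*} [Field K] [AddCommGroup E] [Module K E]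

open Projectivization.Subspace (submodule)

theorem rep_mem_submodule_iff (A : PSub K E) (p : ℙ K E) : p.rep ∈ submodule A ↔ p ∈ A := by
  rw [Projectivization.Subspace.mem_submodule_iff _ p.rep_nonzero, Projectivization.mk_rep]

theorem submodule_sup (A B : PSub K E) : submodule (A ⊔ B) = submodule A ⊔ submodule B := by
  apply le_antisymm
  · rw [← OrderIso.le_symm_apply]
    exact sup_le ((OrderIso.le_symm_apply _).2 le_sup_left)
      ((OrderIso.le_symm_apply _).2 le_sup_right)
  · exact sup_le (submodule.monotone le_sup_left) (submodule.monotone le_sup_right)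

theorem submodule_span (S : Set (ℙ K E)) :
    submodule (Projectivization.Subspace.span S) = Submodule.span K (Projectivization.rep '' S) := by
  apply le_antisymm
  · rw [← OrderIso.le_symm_apply, Projectivization.Subspace.span_le_subspace_iff]
    intro p hp
    rw [SetLike.mem_coe, ← rep_mem_submodule_iff, OrderIso.apply_symm_apply]
    exact Submodule.subset_span ⟨p, hp, rfl⟩
  · rw [Submodule.span_le]
    rintro _ ⟨p, hp, rfl⟩
    exact (rep_mem_submodule_iff _ p).2 (Projectivization.Subspace.subset_span S hp)

theorem submodule_span_singleton (o : ℙ K E) :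
    submodule (Projectivization.Subspace.span {o}) = K ∙ o.rep := by
  rw [submodule_span, Set.image_singleton]

/-- The vectors spanning the points of `X`. -/
def vectors (X : Set (ℙ K E)) : Set E := {e | ∃ h : e ≠ 0, Projectivization.mk K e h ∈ X}

theorem rep_mem_vectors_iff {X : Set (ℙ K E)} {p : ℙ K E} : p.rep ∈ vectors X ↔ p ∈ X := by
  refine ⟨fun ⟨h, hp⟩ => by rwa [Projectivization.mk_rep] at hp, fun hp => ⟨p.rep_nonzero, ?_⟩⟩
  rwa [Projectivization.mk_rep]

theorem smul_mem_vectors {X : Set (ℙ K E)} {e : E} (he : e ∈ vectors X) {c : K} (hc : c ≠ 0) :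
    c • e ∈ vectors X := by
  obtain ⟨h0, he⟩ := he
  refine ⟨smul_ne_zero hc h0, ?_⟩
  convert he using 1
  exact (Projectivization.mk_eq_mk_iff' K _ _ _ _).2 ⟨c, rfl⟩

/-- The line joining two points. -/
theorem hasDim_line {p q : ℙ K E} (hpq : p ≠ q) :
    HasDim (Projectivization.Subspace.span {p, q}) 1 := by
  rw [HasDim, submodule_span, Set.image_pair]
  have hli := Projectivization.linearIndependent_pair_iff_ne.2 hpq
  have := rank_span hli
  rw [Matrix.range_cons_cons_empty] at this
  rw [this]
  have hinj := hli.injective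
  rw [Cardinal.mk_insert, Cardinal.mk_singleton]
  · norm_num
  · rw [Set.mem_singleton_iff]
    intro he
    have : (0 : Fin 2) = 1 := hinj (by simpa using he)
    exact absurd this (by decide)

/-- A line of `W` contains at most two points of an ovoid. -/
theorem IsOvoid.eq_or_eq {W : PSub K E} {O : Set (ℙ K E)} (hO : IsOvoid W O) {p q r : ℙ K E}
    (hp : p ∈ O) (hq : q ∈ O) (hr : r ∈ O) (hpq : p ≠ q)
    (hrpq : r ∈ Projectivization.Subspace.span ({p, q} : Set (ℙ K E))) : r = p ∨ r = q := by
  have hsub := Projectivization.Subspace.subset_span ({p, q} : Set (ℙ K E))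
  have hqL := hsub (Set.mem_insert_of_mem p rfl)
  have hO' : O ⊆ W := by
    rw [← hO.span_eq]; exact Projectivization.Subspace.subset_span O
  obtain ⟨y, -, hy⟩ := hO.secant p hp _ (hasDim_line hpq)
    (Projectivization.Subspace.span_le_subspace_iff.2
      (Set.insert_subset (hO' hp) (Set.singleton_subset_iff.2 (hO' hq))))
    (hsub (Set.mem_insert p _)) (fun he => by
      have : q ∈ ({p} : Set (ℙ K E)) := by rw [← he]; exact ⟨hqL, hq⟩
      exact hpq this.symm)
  by_cases hrp : r = p
  · exact Or.inl hrp
  · exact Or.inr ((hy r ⟨hr, hrpq, hrp⟩).trans (hy q ⟨hq, hqL, hpq.symm⟩).symm)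

/-- Two points span rank at most 2, whereas projective dimension d + 1 means rank d + 2, which is at
least 3. -/
theorem IsOvoid.exists_three {W : PSub K E} {O : Set (ℙ K E)} (hO : IsOvoid W O) {d : ℕ∞}
    (hd : 1 ≤ d) (hW : HasDim W (d + 1)) :
    ∃ p ∈ O, ∃ q ∈ O, ∃ r ∈ O, p ≠ q ∧ p ≠ r ∧ q ≠ r := by
  by_contra! hall
  have hsub : ∃ s : Finset E, s.card ≤ 2 ∧ Projectivization.rep '' O ⊆ s := by
    classical
    by_cases h2 : ∃ p ∈ O, ∃ q ∈ O, p ≠ q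
    · obtain ⟨p, hp, q, hq, hpq⟩ := h2
      refine ⟨{p.rep, q.rep}, Finset.card_le_two, ?_⟩
      rintro _ ⟨r, hr, rfl⟩
      by_cases hpr : p = r
      · simp [hpr]
      · simp [hall p hp q hq r hr hpq hpr]
    · push Not at h2
      by_cases h1 : O.Nonempty
      · obtain ⟨p, hp⟩ := h1
        refine ⟨{p.rep}, by simp, ?_⟩
        rintro _ ⟨r, hr, rfl⟩
        simp [h2 r hr p hp]
      · refine ⟨∅, by simp, ?_⟩
        rw [Set.not_nonempty_iff_eq_empty.1 h1]
        simp
  obtain ⟨s, hs, hOs⟩ := hsub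
  have hr : Module.rank K (submodule W) ≤ (2 : ℕ) := by
    rw [← hO.span_eq, submodule_span]
    refine (Submodule.rank_mono (Submodule.span_mono hOs)).trans ((rank_span_finset_le s).trans ?_)
    exact_mod_cast hs
  rw [← Cardinal.toENat_le_natCast, hW] at hr
  have h3 : (3 : ℕ∞) ≤ d + 1 + 1 := by
    calc (3 : ℕ∞) = 1 + 1 + 1 := by norm_num
      _ ≤ _ := by gcongr
  exact absurd (h3.trans hr) (by decide)

/-- Coordinates in the direct sum of V and W: off the vertex, the W-component is a nonzero multiple
of a point of the ovoid. -/
theorem mem_cone_diff_iff {V W : PSub K E} {O : Set (ℙ K E)} (hVW : Disjoint V W)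
    (hOW : O ⊆ W) {e : E} : e ∈ vectors (cone V O \ V) ↔
      ∃ o ∈ O, ∃ y ∈ submodule V, ∃ c : K, c ≠ 0 ∧ e = y + c • o.rep := by
  have hd : ∀ z ∈ submodule V, z ∈ submodule W → z = 0 := by
    have h1 := hVW.map_orderIso submodule
    exact fun z hz hz' => Submodule.disjoint_def.1 h1 z hz hz'
  constructor
  · rintro ⟨h0, ⟨o, ho, he⟩, hV⟩
    rw [← Projectivization.Subspace.mem_submodule_iff _ h0, submodule_sup,
      submodule_span_singleton, Submodule.mem_sup] at he
    obtain ⟨y, hy, z, hz, rfl⟩ := he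
    obtain ⟨c, rfl⟩ := Submodule.mem_span_singleton.1 hz
    refine ⟨o, ho, y, hy, c, ?_, rfl⟩
    rintro rfl
    apply hV
    rw [SetLike.mem_coe, ← Projectivization.Subspace.mem_submodule_iff _ h0]
    simpa using hy
  · rintro ⟨o, ho, y, hy, c, hc, rfl⟩
    have hV : y + c • o.rep ∉ submodule V := by
      intro h1
      rw [Submodule.add_mem_iff_right _ hy, Submodule.smul_mem_iff _ hc] at h1
      exact o.rep_nonzero (hd _ h1 ((rep_mem_submodule_iff W o).2 (hOW ho)))
    have h0 : y + c • o.rep ≠ 0 := fun h0 => hV (h0 ▸ zero_mem _)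
    refine ⟨h0, ⟨o, ho, ?_⟩, ?_⟩
    · rw [← Projectivization.Subspace.mem_submodule_iff _ h0, submodule_sup,
        submodule_span_singleton]
      exact Submodule.add_mem_sup hy (Submodule.smul_mem _ _ (Submodule.mem_span_singleton_self _))
    · rwa [SetLike.mem_coe, ← Projectivization.Subspace.mem_submodule_iff _ h0]

section Tube

variable {d v : ℕ∞} {ξ V : PSub K E} {C : Set (ℙ K E)}

theorem IsTube.vertex_le (h : IsTube d v ξ V C) : V ≤ ξ := by
  obtain ⟨-, W, O, -, -, rfl, -⟩ := h
  exact le_sup_left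

theorem IsTube.vertex_ne_bot (h : IsTube d v ξ V C) : submodule V ≠ ⊥ := by
  intro h0
  have h1 := h.1
  rw [HasDim, h0, rank_bot, map_zero] at h1
  exact absurd h1.symm (by simp)

theorem IsTube.notMem_vertex (h : IsTube d v ξ V C) {e : E} (he : e ∈ vectors C) :
    e ∉ submodule V := by
  obtain ⟨-, W, O, -, -, -, -, rfl⟩ := h
  obtain ⟨h0, -, hV⟩ := he
  rwa [Projectivization.Subspace.mem_submodule_iff _ h0]

theorem IsTube.add_mem_set (h : IsTube d v ξ V C) {e y : E} (he : e ∈ vectors C)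
    (hy : y ∈ submodule V) : e + y ∈ vectors C := by
  obtain ⟨-, W, O, -, hVW, -, hO, rfl⟩ := h
  have hOW : O ⊆ W := by rw [← hO.span_eq]; exact Projectivization.Subspace.subset_span O
  rw [mem_cone_diff_iff hVW hOW] at he ⊢
  obtain ⟨o, ho, z, hz, c, hc, rfl⟩ := he
  exact ⟨o, ho, z + y, add_mem hz hy, c, hc, by abel⟩

/-- If a and b lay over distinct points o, o' of the ovoid, the W-component of a + b would be
nonzero. It would give a third point of the ovoid on the line oo', contrary to `IsOvoid.eq_or_eq`.
-/
theorem IsTube.generator (h : IsTube d v ξ V C) {a b : E} (ha : a ∈ vectors C)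
    (hb : b ∈ vectors C) (hab : a + b ∈ vectors C ∨ a + b ∈ submodule V) :
    ∃ c : K, b - c • a ∈ submodule V := by
  obtain ⟨-, W, O, -, hVW, -, hO, rfl⟩ := h
  have hOW : O ⊆ W := by rw [← hO.span_eq]; exact Projectivization.Subspace.subset_span O
  have hW : ∀ {o : ℙ K E}, o ∈ O → o.rep ∈ submodule W := fun {o} ho =>
    (rep_mem_submodule_iff W o).2 (hOW ho)
  have hd : ∀ z ∈ submodule V, z ∈ submodule W → z = 0 := by
    have h1 := hVW.map_orderIso submodule
    exact fun z hz hz' => Submodule.disjoint_def.1 h1 z hz hz'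
  rw [mem_cone_diff_iff hVW hOW] at ha hb hab
  obtain ⟨o, ho, y, hy, s, hs, rfl⟩ := ha
  obtain ⟨o', ho', y', hy', t, ht, rfl⟩ := hb
  by_cases hoo : o = o'
  · subst hoo
    refine ⟨t / s, ?_⟩
    rw [show (y' + t • o.rep) - (t / s) • (y + s • o.rep)
      = y' - (t / s) • y + (t - t / s * s) • o.rep by module, div_mul_cancel₀ _ hs, sub_self,
      zero_smul, add_zero]
    exact sub_mem hy' (Submodule.smul_mem _ _ hy)
  exfalso
  have hli := LinearIndependent.pair_iff.1 (Projectivization.linearIndependent_pair_iff_ne.2 hoo)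
  have hyy := add_mem hy hy'
  have hww : s • o.rep + t • o'.rep ∈ submodule W :=
    add_mem (Submodule.smul_mem _ _ (hW ho)) (Submodule.smul_mem _ _ (hW ho'))
  rw [show y + s • o.rep + (y' + t • o'.rep) = (y + y') + (s • o.rep + t • o'.rep) by abel] at hab
  rcases hab with ⟨r, hr, z, hz, c, hc, he⟩ | hab
  · have he' : (s • o.rep + t • o'.rep) - c • r.rep = z - (y + y') := by
      rw [sub_eq_sub_iff_add_eq_add, add_comm, he]
    have h0 := hd _ (he' ▸ sub_mem hz hyy) (sub_mem hww (Submodule.smul_mem _ _ (hW hr)))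
    rw [sub_eq_zero] at h0
    have hline : r ∈ Projectivization.Subspace.span ({o, o'} : Set (ℙ K E)) := by
      rw [← rep_mem_submodule_iff, submodule_span, Set.image_pair, ← Submodule.smul_mem_iff _ hc,
        ← h0]
      exact Submodule.mem_span_pair.2 ⟨s, t, rfl⟩
    rcases hO.eq_or_eq ho ho' hr hoo hline with rfl | rfl
    · exact ht (hli (s - c) t (by rw [sub_smul, ← h0]; abel)).2
    · exact hs (hli s (t - c) (by rw [sub_smul, ← h0]; abel)).1
  · exact hs (hli s t (hd _ ((Submodule.add_mem_iff_right _ hyy).1 hab) hww)).1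

theorem IsTube.exists_three (hd : 1 ≤ d) (h : IsTube d v ξ V C) :
    ∃ a ∈ vectors C, ∃ b ∈ vectors C, ∃ c ∈ vectors C, ∀ k : K,
      b - k • a ∉ submodule V ∧ c - k • a ∉ submodule V ∧ c - k • b ∉ submodule V := by
  obtain ⟨-, W, O, hWd, hVW, -, hO, rfl⟩ := h
  have hOW : O ⊆ W := by rw [← hO.span_eq]; exact Projectivization.Subspace.subset_span O
  have hW : ∀ {o : ℙ K E}, o ∈ O → o.rep ∈ submodule W := fun {o} ho =>
    (rep_mem_submodule_iff W o).2 (hOW ho)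
  have hdis : ∀ z ∈ submodule V, z ∈ submodule W → z = 0 := by
    have h1 := hVW.map_orderIso submodule
    exact fun z hz hz' => Submodule.disjoint_def.1 h1 z hz hz'
  have hmem : ∀ {o : ℙ K E}, o ∈ O → o.rep ∈ vectors (cone V O \ V) := fun {o} ho =>
    (mem_cone_diff_iff hVW hOW).2 ⟨o, ho, 0, zero_mem _, 1, one_ne_zero, by simp⟩
  have hne : ∀ {o o' : ℙ K E}, o ∈ O → o' ∈ O → o ≠ o' → ∀ k : K,
      o'.rep - k • o.rep ∉ submodule V := by
    intro o o' ho ho' hoo k hk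
    have h0 := hdis _ hk (sub_mem (hW ho') (Submodule.smul_mem _ _ (hW ho)))
    have hli := LinearIndependent.pair_iff.1
      (Projectivization.linearIndependent_pair_iff_ne.2 hoo)
    exact one_ne_zero (hli (-k) 1 (by rw [← h0]; module)).2
  obtain ⟨p, hp, q, hq, r, hr, hpq, hpr, hqr⟩ := hO.exists_three hd hWd
  exact ⟨p.rep, hmem hp, q.rep, hmem hq, r.rep, hmem hr, fun k =>
    ⟨hne hp hq hpq k, hne hp hr hpr k, hne hq hr hqr k⟩⟩

end Tube

theorem exists_ne_zero_ne_one (hK : 2 < ENat.card K) : ∃ k : K, k ≠ 0 ∧ k ≠ 1 := by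
  by_contra! hall
  have hu : (Set.univ : Set K) ⊆ {0, 1} := fun k _ => by
    by_cases h0 : k = 0
    · exact Or.inl h0
    · exact Or.inr (hall k h0)
  have := (Set.encard_le_encard hu).trans (Set.encard_insert_le {1} 0)
  rw [Set.encard_univ, Set.encard_singleton, one_add_one_eq_two] at this
  exact absurd hK (not_lt.2 this)

namespace TubicSet

variable {d v : ℕ∞} (S : TubicSet K E d v)

theorem isTube_vertex (ξ : S.Ξ) : IsTube d v ξ (S.vertex ξ) (S.X ∩ (ξ : PSub K E)) :=
  (S.exists_tube ξ ξ.2).choose_spec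

theorem mem_vectors_inter_iff {X : Set (ℙ K E)} {ξ : PSub K E} {e : E} :
    e ∈ vectors (X ∩ ξ) ↔ e ∈ vectors X ∧ e ∈ submodule ξ := by
  constructor
  · rintro ⟨h0, hX, hξ⟩
    exact ⟨⟨h0, hX⟩, (Projectivization.Subspace.mem_submodule_iff _ h0).2 hξ⟩
  · rintro ⟨⟨h0, hX⟩, hξ⟩
    exact ⟨h0, hX, (Projectivization.Subspace.mem_submodule_iff _ h0).1 hξ⟩

theorem isTubeSystem (hd : 1 ≤ d) (hS : S.IsHjelmslevean) (hV : S.VertexReduced) :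
    IsTubeSystem (vectors S.X) (fun ξ : S.Ξ => submodule (ξ : PSub K E))
      (fun ξ => submodule (S.vertex ξ)) := by
  -- (H1) concerns distinct points only; a second point is needed to find a tubic space through a
  -- given one.
  have hne : ∃ p ∈ S.X, ∃ q ∈ S.X, p ≠ q := by
    obtain ⟨ξ, -⟩ := hV.2
    obtain ⟨a, ha, b, hb, _, _, h⟩ := (S.isTube_vertex ξ).exists_three hd
    refine ⟨_, ha.2.1, _, hb.2.1, fun he => ?_⟩
    obtain ⟨k, hk⟩ := (Projectivization.mk_eq_mk_iff' K _ _ _ _).1 he.symm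
    apply (h k).1
    rw [hk, sub_self]
    exact zero_mem _
  have hjoin : ∀ p ∈ S.X, ∀ q ∈ S.X, ∃ ξ : S.Ξ, p ∈ (ξ : PSub K E) ∧ q ∈ (ξ : PSub K E) := by
    intro p hp q hq
    by_cases hpq : p = q
    · subst hpq
      obtain ⟨r, hr, s, hs, hrs⟩ := hne
      by_cases hpr : p = r
      · obtain ⟨ξ, h, -⟩ := hS.h1 p hp s hs (hpr ▸ hrs)
        exact ⟨ξ, h, h⟩
      · obtain ⟨ξ, h, -⟩ := hS.h1 p hp r hr hpr
        exact ⟨ξ, h, h⟩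
    · exact hS.h1 p hp q hq hpq
  refine ⟨fun x hx c hc => smul_mem_vectors hx hc,
    fun ξ => submodule.monotone (S.isTube_vertex ξ).vertex_le,
    fun ξ => (S.isTube_vertex ξ).vertex_ne_bot, ?_, ?_, ?_, ?_, ?_, ?_, ?_, ?_, ?_⟩
  · intro x hx ξ hxV
    exact (S.isTube_vertex ξ).notMem_vertex
      (mem_vectors_inter_iff.2 ⟨hx, submodule.monotone (S.isTube_vertex ξ).vertex_le hxV⟩) hxV
  · intro ξ x hx hxξ y hy
    exact (mem_vectors_inter_iff.1
      ((S.isTube_vertex ξ).add_mem_set (mem_vectors_inter_iff.2 ⟨hx, hxξ⟩) hy)).1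
  · intro ξ a ha haξ b hb hbξ hab
    exact (S.isTube_vertex ξ).generator (mem_vectors_inter_iff.2 ⟨ha, haξ⟩)
      (mem_vectors_inter_iff.2 ⟨hb, hbξ⟩)
      (hab.imp_left fun h => mem_vectors_inter_iff.2 ⟨h, add_mem haξ hbξ⟩)
  · intro ξ
    obtain ⟨a, ha, b, hb, c, hc, h⟩ := (S.isTube_vertex ξ).exists_three hd
    rw [mem_vectors_inter_iff] at ha hb hc
    exact ⟨a, ha.1, b, hb.1, c, hc.1, ha.2, hb.2, hc.2, h⟩
  · rintro a ⟨ha0, ha⟩ b ⟨hb0, hb⟩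
    obtain ⟨ξ, h, h'⟩ := hjoin _ ha _ hb
    exact ⟨ξ, (Projectivization.Subspace.mem_submodule_iff _ ha0).2 h,
      (Projectivization.Subspace.mem_submodule_iff _ hb0).2 h'⟩
  · intro ξ ξ' hξ
    obtain ⟨p, ⟨hp, hp'⟩, hpX⟩ := hS.h2' ξ ξ' hξ
    exact ⟨p.rep, rep_mem_vectors_iff.2 hpX, (rep_mem_submodule_iff _ p).2 hp,
      (rep_mem_submodule_iff _ p).2 hp'⟩
  · intro ξ ξ' hξ z hz hz' hz0
    rw [Projectivization.Subspace.mem_submodule_iff _ hz0] at hz hz'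
    have h : Projectivization.mk K z hz0 ∈ S.tubeCone ξ ∩ S.tubeCone ξ' := by
      rw [← hS.h2 ξ ξ' hξ]; exact ⟨hz, hz'⟩
    exact h.1.imp (fun h => ⟨hz0, h.1⟩)
      (fun h => (Projectivization.Subspace.mem_submodule_iff _ hz0).2 h)
  · intro ξ ξ' y hy hy' hy0
    rcases hV.1 ξ ξ' with h | h
    · rw [h]
    · exact absurd (Submodule.disjoint_def.1 (h.map_orderIso submodule) y hy hy') hy0
  · obtain ⟨ξ, ξ', h⟩ := hV.2
    refine ⟨ξ, ξ', fun he => (S.isTube_vertex ξ).vertex_ne_bot ?_⟩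
    have h1 := h.map_orderIso submodule
    rwa [← he, disjoint_self] at h1

end TubicSet

end HVeronese

/-! ### Maximal singular subspaces and the incidence properties -/

/-- The properties of points `P`, tubes `T`, and of the maps `q`, `r` onto the dual plane with
incidence relation `J` from which the structure of a Hjelmslev plane of level 2 is derived. -/
structure IsHjelmslevSystem {P T A B : Type*} (I : P → T → Prop) (q : P → A) (r : T → B)
    (J : A → B → Prop) : Prop where
  nonempty : Nonempty T
  joined : ∀ x y, ∃ C, I x C ∧ I y C
  meet : ∀ C D, ∃ x, I x C ∧ I x D
  surjective_points : Function.Surjective q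
  surjective_lines : Function.Surjective r
  inc_iff : ∀ x C, J (q x) (r C) ↔ ∃ D, I x D ∧ r D = r C
  point_eq : ∀ C D, C ≠ D → ∀ x y, I x C → I x D → I y C → I y D → q x = q y
  eq_of_vertex_ne : ∀ C D, r C ≠ r D → ∀ x y, I x C → I x D → I y C → I y D → x = y
  line_eq : ∀ x y, q x ≠ q y → ∀ l m, J (q x) l → J (q x) m → J (q y) l → J (q y) m → l = m
  exists_other : ∀ x C, I x C → ∃ D, D ≠ C ∧ I x D ∧ r D = r C
  exists_vertex_ne : ∀ x C, I x C → ∃ D, I x D ∧ r D ≠ r C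
  exists_three : ∀ C, ∃ a b c, I a C ∧ I b C ∧ I c C ∧ q a ≠ q b ∧ q a ≠ q c ∧ q b ≠ q c
  inc_of_inc : ∀ C D, r C = r D → ∀ x y, q x = q y → I x C → I x D → I y C → I y D
  exists_near : ∀ x C, I x C → ∃ y, y ≠ x ∧ I y C ∧ q y = q x

namespace HVeronese

variable {K E : Type*} [Field K] [AddCommGroup E] [Module K E]

open Projectivization.Subspace (submodule)

theorem IsTubeSystem.comp {ι κ : Type*} {X : Set E} {U V : ι → Submodule K E}
    (h : IsTubeSystem X U V) (f : κ ≃ ι) : IsTubeSystem X (U ∘ f) (V ∘ f) where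
  smul_mem_set := h.smul_mem_set
  vertex_le i := h.vertex_le (f i)
  vertex_ne_bot i := h.vertex_ne_bot (f i)
  notMem_vertex x hx i := h.notMem_vertex x hx (f i)
  add_mem_set i := h.add_mem_set (f i)
  generator i := h.generator (f i)
  exists_three i := h.exists_three (f i)
  joined a ha b hb := by
    obtain ⟨i, hi⟩ := h.joined a ha b hb
    obtain ⟨j, rfl⟩ := f.surjective i
    exact ⟨j, hi⟩
  meet i j hij := h.meet (f i) (f j) (f.injective.ne hij)
  inter i j hij := h.inter (f i) (f j) (f.injective.ne hij)
  reduced i j := h.reduced (f i) (f j)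
  exists_ne := by
    obtain ⟨i, j, hij⟩ := h.exists_ne
    obtain ⟨i, rfl⟩ := f.surjective i
    obtain ⟨j, rfl⟩ := f.surjective j
    exact ⟨i, j, hij⟩

namespace TubicSet

variable {d v : ℕ∞} (S : TubicSet K E d v)

/-- The vectors of the tubic space of a tube. -/
noncomputable def tubeSpace (C : S.Tube) : Submodule K E := submodule (S.tubicSpace C : PSub K E)

/-- The vectors of the vertex of a tube. -/
noncomputable def tubeVertex (C : S.Tube) : Submodule K E := submodule (S.vertex (S.tubicSpace C))

theorem coe_eq_inter_tubicSpace (C : S.Tube) : C.1 = S.X ∩ (S.tubicSpace C : PSub K E) :=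
  C.2.choose_spec

theorem inc_iff_mem_tubicSpace (x : S.X) (C : S.Tube) :
    S.Inc x C ↔ (x : ℙ K E).rep ∈ S.tubeSpace C := by
  rw [tubeSpace, rep_mem_submodule_iff, Inc, coe_eq_inter_tubicSpace]
  exact and_iff_right x.2

theorem tubicSpace_injective : Function.Injective S.tubicSpace := fun C D h => by
  apply Subtype.ext
  rw [coe_eq_inter_tubicSpace, h, ← coe_eq_inter_tubicSpace]

variable {S}

/-- A tube determines its tubic space: common points of two distinct tubic spaces are on one
generator, but a tube has several. Hence tubes may replace tubic spaces as indices. -/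
theorem tubicSpace_surjective (hd : 1 ≤ d) (hS : S.IsHjelmslevean) (hV : S.VertexReduced) :
    Function.Surjective S.tubicSpace := by
  intro ξ
  let C : S.Tube := ⟨S.X ∩ (ξ : PSub K E), ξ, rfl⟩
  refine ⟨C, ?_⟩
  by_contra hne
  have h := S.isTubeSystem hd hS hV
  have hC := S.coe_eq_inter_tubicSpace C
  have hmem : ∀ a ∈ vectors S.X, a ∈ submodule (ξ : PSub K E) →
      a ∈ S.tubeSpace C := fun a ha haξ => by
    have h1 : a ∈ vectors C.1 := mem_vectors_inter_iff.2 ⟨ha, haξ⟩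
    rw [hC] at h1
    exact (mem_vectors_inter_iff.1 h1).2
  obtain ⟨a, ha, b, hb, _, _, haξ, hbξ, -, hn⟩ := h.exists_three ξ
  obtain ⟨c, hc⟩ := h.exists_sub_smul_mem (Ne.symm hne) ha hb haξ (hmem a ha haξ) hbξ
    (hmem b hb hbξ)
  exact (hn c).1 hc

/-- The tubic spaces and vertices of the tubes, in terms of vectors. -/
theorem isTubeSystem_tube (hd : 1 ≤ d) (hS : S.IsHjelmslevean) (hV : S.VertexReduced) :
    IsTubeSystem (vectors S.X) S.tubeSpace
      S.tubeVertex :=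
  (S.isTubeSystem hd hS hV).comp
    (Equiv.ofBijective _ ⟨S.tubicSpace_injective, tubicSpace_surjective hd hS hV⟩)

variable (S) in
/-- The span of the vertices of the tubes through `x`, in terms of vectors. -/
noncomputable def tubePencil (x : ℙ K E) : Submodule K E :=
  IsTubeSystem.pencil S.tubeSpace
      S.tubeVertex x.rep

theorem mem_Y_iff (hd : 1 ≤ d) (hS : S.IsHjelmslevean) (hV : S.VertexReduced) {y : E}
    (hy : y ≠ 0) : Projectivization.mk K y hy ∈ S.Y ↔
      ∃ C : S.Tube, y ∈ S.tubeVertex C := by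
  constructor
  · rintro ⟨ξ, h⟩
    obtain ⟨C, rfl⟩ := tubicSpace_surjective hd hS hV ξ
    exact ⟨C, (Projectivization.Subspace.mem_submodule_iff _ hy).2 h⟩
  · rintro ⟨C, h⟩
    exact ⟨S.tubicSpace C, (Projectivization.Subspace.mem_submodule_iff _ hy).1 h⟩

/-- For y at infinity in A, the vector x + y is in X, and a tubic space joining it to x contains y,
hence has y in its vertex. So infinity lies in the pencil; being a hyperplane of A that misses x, it
spans A together with x. -/
theorem le_of_isSingularAffine (hd : 1 ≤ d)
    (hS : S.IsHjelmslevean) (hV : S.VertexReduced) {x : ℙ K E} (hx : x ∈ S.X) {A : PSub K E}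
    (hA : S.IsSingularAffine A) (hxA : x ∈ A) :
    submodule A ≤ (K ∙ x.rep) ⊔ S.tubePencil x := by
  have h := isTubeSystem_tube hd hS hV
  have hxv := rep_mem_vectors_iff.2 hx
  have hxA' := (rep_mem_submodule_iff A x).2 hxA
  obtain ⟨hAX, H, hHA, hH⟩ := hA
  have hY : ∀ y ∈ submodule H, y ≠ 0 → ∃ C : S.Tube, y ∈ S.tubeVertex C := by
    intro y hy hy0
    rw [Projectivization.Subspace.mem_submodule_iff _ hy0] at hy
    have h1 : Projectivization.mk K y hy0 ∈ (H : Set (ℙ K E)) := hy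
    rw [hH] at h1
    exact (mem_Y_iff hd hS hV hy0).1 h1.2
  have hX : ∀ a ∈ submodule A, a ∉ submodule H → a ∈ vectors S.X := by
    intro a ha haH
    have ha0 : a ≠ 0 := fun h0 => haH (h0 ▸ zero_mem _)
    rw [Projectivization.Subspace.mem_submodule_iff _ ha0] at ha haH
    rcases hAX ha with h1 | h1
    · exact ⟨ha0, h1⟩
    · exact absurd (show Projectivization.mk K a ha0 ∈ (H : Set (ℙ K E)) from
        hH ▸ ⟨ha, h1⟩) haH
  have hle : submodule H ≤ submodule A := submodule.monotone hHA.le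
  have hxH : x.rep ∉ submodule H := fun h1 => by
    obtain ⟨C, hC⟩ := hY _ h1 x.rep_nonzero
    exact h.notMem_vertex _ hxv C hC
  have hHp : submodule H ≤ S.tubePencil x := by
    intro y hy
    by_cases hy0 : y = 0
    · rw [hy0]; exact zero_mem _
    have hxy : x.rep + y ∈ vectors S.X :=
      hX _ (add_mem hxA' (hle hy)) fun h1 => hxH ((Submodule.add_mem_iff_left _ hy).1 h1)
    obtain ⟨C, hC, hC'⟩ := h.joined _ hxv _ hxy
    obtain ⟨D, hD⟩ := hY y hy hy0
    exact IsTubeSystem.le_pencil hC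
      (h.mem_vertex_of_mem hD ((Submodule.add_mem_iff_right _ hC).1 hC'))
  have hcov : submodule H ⋖ submodule A := (apply_covBy_apply_iff submodule).2 hHA
  have heq : (K ∙ x.rep) ⊔ submodule H = submodule A := by
    refine (hcov.eq_or_eq le_sup_right (sup_le ?_ hle)).resolve_left fun h1 => hxH ?_
    · rwa [Submodule.span_singleton_le_iff_mem]
    · rw [← h1]
      exact Submodule.mem_sup_left (Submodule.mem_span_singleton_self _)
  rw [← heq]
  exact sup_le_sup_left hHp _

theorem mem_span_sup_tubePencil (hK : ∃ k : K, k ≠ 0 ∧ k ≠ 1) (hd : 1 ≤ d)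
    (hS : S.IsHjelmslevean) (hV : S.VertexReduced) {x : ℙ K E} (hx : x ∈ S.X) {a : E}
    (ha : a ∈ (K ∙ x.rep) ⊔ S.tubePencil x) : a ∈ vectors S.X ∨ a ∈ S.tubePencil x := by
  have h := isTubeSystem_tube hd hS hV
  obtain ⟨z, hz, y, hy, rfl⟩ := Submodule.mem_sup.1 ha
  obtain ⟨c, rfl⟩ := Submodule.mem_span_singleton.1 hz
  by_cases hc : c = 0
  · right; rwa [hc, zero_smul, zero_add]
  · left
    refine h.add_mem_of_mem_pencil hK (smul_mem_vectors (rep_mem_vectors_iff.2 hx) hc) ?_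
    rwa [IsTubeSystem.pencil_smul hc]

theorem mem_tubePencil_iff (hK : ∃ k : K, k ≠ 0 ∧ k ≠ 1) (hd : 1 ≤ d)
    (hS : S.IsHjelmslevean) (hV : S.VertexReduced) {x : ℙ K E} (hx : x ∈ S.X) {a : E}
    (ha : a ∈ (K ∙ x.rep) ⊔ S.tubePencil x) (ha0 : a ≠ 0) :
    a ∈ S.tubePencil x ↔ Projectivization.mk K a ha0 ∈ S.Y := by
  have h := isTubeSystem_tube hd hS hV
  rw [mem_Y_iff hd hS hV]
  constructor
  · intro hp
    obtain ⟨C, -, hC⟩ := (h.mem_pencil_iff hK (rep_mem_vectors_iff.2 hx)).1 hp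
    exact ⟨C, hC⟩
  · rintro ⟨C, hC⟩
    exact (mem_span_sup_tubePencil hK hd hS hV hx ha).resolve_left
      fun hX => h.notMem_vertex a hX C hC

theorem isSingularAffine_tubePencil (hK : ∃ k : K, k ≠ 0 ∧ k ≠ 1) (hd : 1 ≤ d)
    (hS : S.IsHjelmslevean) (hV : S.VertexReduced) {x : ℙ K E} (hx : x ∈ S.X) :
    S.IsSingularAffine ((K ∙ x.rep) ⊔ S.tubePencil x).projectivization := by
  have h := isTubeSystem_tube hd hS hV
  refine ⟨?_, (S.tubePencil x).projectivization, ?_, ?_⟩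
  · intro p hp
    induction p using Projectivization.ind with | h a ha0 => ?_
    have ha : a ∈ (K ∙ x.rep) ⊔ S.tubePencil x := hp
    exact (mem_span_sup_tubePencil hK hd hS hV hx ha).imp (fun h => h.2)
      (mem_tubePencil_iff hK hd hS hV hx ha ha0).1
  · rw [apply_covBy_apply_iff]
    have hxv := rep_mem_vectors_iff.2 hx
    exact Submodule.covBy_span_singleton_sup (h.notMem_pencil hK hxv hxv)
  · ext p
    induction p using Projectivization.ind with | h a ha0 => ?_
    constructor
    · intro hp
      have ha : a ∈ S.tubePencil x := hp
      have ha' := Submodule.mem_sup_right (S := K ∙ x.rep) ha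
      exact ⟨ha', (mem_tubePencil_iff hK hd hS hV hx ha' ha0).1 ha⟩
    · rintro ⟨ha, haY⟩
      exact (mem_tubePencil_iff hK hd hS hV hx ha ha0).2 haY

/-- The upper bound of `le_of_isSingularAffine` is itself singular affine, so the supremum is
attained. -/
theorem piBar_eq (hK : ∃ k : K, k ≠ 0 ∧ k ≠ 1) (hd : 1 ≤ d)
    (hS : S.IsHjelmslevean) (hV : S.VertexReduced) {x : ℙ K E} (hx : x ∈ S.X) :
    S.piBar x = ((K ∙ x.rep) ⊔ S.tubePencil x).projectivization := by
  apply le_antisymm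
  · refine sSup_le fun A hA => ?_
    rw [OrderIso.le_symm_apply]
    exact le_of_isSingularAffine hd hS hV hx hA.1 hA.2
  · refine le_sSup ⟨isSingularAffine_tubePencil hK hd hS hV hx, ?_⟩
    rw [← rep_mem_submodule_iff, OrderIso.apply_symm_apply]
    exact Submodule.mem_sup_left (Submodule.mem_span_singleton_self _)

theorem piY_eq (hK : ∃ k : K, k ≠ 0 ∧ k ≠ 1) (hd : 1 ≤ d)
    (hS : S.IsHjelmslevean) (hV : S.VertexReduced) {x : ℙ K E} (hx : x ∈ S.X) :
    S.piY x = (S.tubePencil x).projectivization := by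
  rw [piY, piBar_eq hK hd hS hV hx]
  ext p
  induction p using Projectivization.ind with | h a ha0 => ?_
  constructor
  · rintro ⟨ha, haY⟩
    exact (mem_tubePencil_iff hK hd hS hV hx ha ha0).2 haY
  · intro hp
    have ha : a ∈ S.tubePencil x := hp
    have ha' := Submodule.mem_sup_right (S := K ∙ x.rep) ha
    exact ⟨ha', (mem_tubePencil_iff hK hd hS hV hx ha' ha0).1 ha⟩

theorem chi_eq_iff (hK : ∃ k : K, k ≠ 0 ∧ k ≠ 1) (hd : 1 ≤ d)
    (hS : S.IsHjelmslevean) (hV : S.VertexReduced) (x y : S.X) :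
    S.chi x = S.chi y ↔ S.tubePencil x = S.tubePencil y := by
  refine Subtype.ext_iff.trans ?_
  change S.piY x = S.piY y ↔ _
  rw [piY_eq hK hd hS hV x.2, piY_eq hK hd hS hV y.2,
    SetLike.coe_set_eq, submodule.symm.injective.eq_iff]

theorem chiLine_eq_iff (C D : S.Tube) : S.chiLine C = S.chiLine D ↔
    S.tubeVertex C = S.tubeVertex D := by
  refine Subtype.ext_iff.trans ?_
  change (S.vertex (S.tubicSpace C) : Set (ℙ K E)) = S.vertex (S.tubicSpace D) ↔ _
  rw [tubeVertex, tubeVertex, SetLike.coe_set_eq, submodule.injective.eq_iff]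

theorem dualInc_iff (hK : ∃ k : K, k ≠ 0 ∧ k ≠ 1) (hd : 1 ≤ d)
    (hS : S.IsHjelmslevean) (hV : S.VertexReduced) (x : S.X) (C : S.Tube) :
    S.DualInc (S.chi x) (S.chiLine C) ↔
      S.tubeVertex C ≤ S.tubePencil x := by
  rw [tubeVertex, ← OrderIso.le_symm_apply, ← SetLike.coe_subset_coe, ← piY_eq hK hd hS hV x.2]
  rfl

theorem surjective_chi : Function.Surjective S.chi := by
  rintro ⟨p, x, rfl⟩
  exact ⟨x, rfl⟩

theorem surjective_chiLine (hd : 1 ≤ d) (hS : S.IsHjelmslevean) (hV : S.VertexReduced) :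
    Function.Surjective S.chiLine := by
  rintro ⟨l, ξ, rfl⟩
  obtain ⟨C, rfl⟩ := tubicSpace_surjective hd hS hV ξ
  exact ⟨C, rfl⟩

theorem exists_inc_of_mem {C : S.Tube} {a : E} (ha : a ∈ vectors S.X)
    (haC : a ∈ S.tubeSpace C) :
    ∃ x : S.X, S.Inc x C ∧ ∃ c : K, c ≠ 0 ∧ (x : ℙ K E).rep = c • a := by
  obtain ⟨ha0, haX⟩ := ha
  obtain ⟨c, hc⟩ := Projectivization.exists_smul_eq_mk_rep K a ha0
  refine ⟨⟨_, haX⟩, ?_, c, c.ne_zero, hc.symm⟩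
  rw [inc_iff_mem_tubicSpace, tubeSpace, rep_mem_submodule_iff]
  exact (Projectivization.Subspace.mem_submodule_iff _ ha0).1 haC

theorem isHjelmslevSystem (hK : ∃ k : K, k ≠ 0 ∧ k ≠ 1) (hd : 1 ≤ d)
    (hS : S.IsHjelmslevean) (hV : S.VertexReduced) :
    IsHjelmslevSystem S.Inc S.chi S.chiLine S.DualInc := by
  have h := isTubeSystem_tube hd hS hV
  have hX : ∀ x : S.X, (x : ℙ K E).rep ∈ vectors S.X := fun x => rep_mem_vectors_iff.2 x.2
  have hI := S.inc_iff_mem_tubicSpace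
  have hchi := chi_eq_iff hK hd hS hV
  have hle : ∀ (x : S.X) (C : S.Tube), S.Inc x C →
      S.tubeVertex C ≤ S.tubePencil x := fun x C hC =>
    IsTubeSystem.le_pencil ((hI x C).1 hC)
  have hnear : ∀ x y : S.X, S.chi y = S.chi x ↔
      ∃ c : K, (y : ℙ K E).rep - c • (x : ℙ K E).rep ∈ S.tubePencil x := fun x y =>
    (hchi y x).trans (h.pencil_eq_iff hK (hX x) (hX y))
  have hother : ∀ x C, S.Inc x C → ∃ D, D ≠ C ∧ S.Inc x D ∧ S.chiLine D = S.chiLine C := by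
    intro x C hC
    obtain ⟨D, hDC, hxD, hD⟩ := h.exists_ne_vertex_eq hK (hX x) ((hI x C).1 hC)
    exact ⟨D, hDC, (hI x D).2 hxD, (chiLine_eq_iff D C).2 hD⟩
  have hthree : ∀ C, ∃ a b c, S.Inc a C ∧ S.Inc b C ∧ S.Inc c C ∧ S.chi a ≠ S.chi b ∧
      S.chi a ≠ S.chi c ∧ S.chi b ≠ S.chi c := by
    intro C
    obtain ⟨a, ha, b, hb, c, hc, haC, hbC, hcC, hn⟩ := h.exists_noncollinear hK C
    obtain ⟨x, hx, s, hs, hxs⟩ := exists_inc_of_mem ha haC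
    obtain ⟨y, hy, t, ht, hyt⟩ := exists_inc_of_mem hb hbC
    obtain ⟨z, hz, u, hu, hzu⟩ := exists_inc_of_mem hc hcC
    refine ⟨x, y, z, hx, hy, hz, ?_, ?_, ?_⟩ <;>
      rw [Ne, hchi, tubePencil, tubePencil] <;> simp only [hxs, hyt, hzu]
    · rw [IsTubeSystem.pencil_smul hs, IsTubeSystem.pencil_smul ht, eq_comm,
        h.pencil_eq_iff hK ha hb, not_exists]
      exact fun k => (hn k).1
    · rw [IsTubeSystem.pencil_smul hs, IsTubeSystem.pencil_smul hu, eq_comm,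
        h.pencil_eq_iff hK ha hc, not_exists]
      exact fun k => (hn k).2.1
    · rw [IsTubeSystem.pencil_smul ht, IsTubeSystem.pencil_smul hu, eq_comm,
        h.pencil_eq_iff hK hb hc, not_exists]
      exact fun k => (hn k).2.2
  have hne : Nonempty S.Tube := let ⟨C, _⟩ := h.exists_ne; ⟨C⟩
  refine ⟨hne, ?_, ?_, surjective_chi, surjective_chiLine hd hS hV, ?_, ?_, ?_, ?_, hother, ?_, hthree,
    ?_, ?_⟩
  · intro x y
    obtain ⟨C, hx, hy⟩ := h.joined _ (hX x) _ (hX y)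
    exact ⟨C, (hI x C).2 hx, (hI y C).2 hy⟩
  · intro C D
    by_cases hCD : C = D
    · subst hCD
      obtain ⟨a, _, _, ha, -⟩ := hthree C
      exact ⟨a, ha, ha⟩
    · obtain ⟨a, ha, haC, haD⟩ := h.meet C D hCD
      obtain ⟨x, hx, c, hc, hxc⟩ := exists_inc_of_mem ha haC
      exact ⟨x, hx, (hI x D).2 (hxc ▸ Submodule.smul_mem _ _ haD)⟩
  · intro x C
    rw [dualInc_iff hK hd hS hV]
    constructor
    · intro hC
      obtain ⟨D, hD, hDC⟩ := h.exists_vertex_eq hK (hX x) hC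
      exact ⟨D, (hI x D).2 hD, (chiLine_eq_iff D C).2 hDC⟩
    · rintro ⟨D, hD, hDC⟩
      rw [← (chiLine_eq_iff D C).1 hDC]
      exact hle x D hD
  · intro C D hCD x y hxC hxD hyC hyD
    rw [hI] at hxC hxD hyC hyD
    obtain ⟨c, hc⟩ := h.exists_sub_smul_mem hCD (hX x) (hX y) hxC hxD hyC hyD
    exact ((hnear x y).2 ⟨c, IsTubeSystem.le_pencil hxC hc⟩).symm
  · intro C D hr x y hxC hxD hyC hyD
    have hCD : C ≠ D := fun h => hr (h ▸ rfl)
    rw [hI] at hxC hxD hyC hyD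
    obtain ⟨c, hc⟩ := h.exists_sub_smul_mem hCD (hX x) (hX y) hxC hxD hyC hyD
    have hcD := h.mem_vertex_of_mem hc (sub_mem hyD (Submodule.smul_mem _ c hxD))
    -- This difference is in both vertices, which are disjoint; so it vanishes and the points
    -- coincide.
    by_cases h0 : (y : ℙ K E).rep - c • (x : ℙ K E).rep = 0
    · apply Subtype.ext
      rw [← Projectivization.mk_rep (x : ℙ K E), ← Projectivization.mk_rep (y : ℙ K E)]
      exact ((Projectivization.mk_eq_mk_iff' K _ _ _ _).2 ⟨c, (sub_eq_zero.1 h0).symm⟩).symm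
    · exact absurd ((chiLine_eq_iff C D).2 (h.reduced C D _ hc hcD h0)) hr
  · intro x y hxy l m hxl hxm hyl hym
    obtain ⟨C, rfl⟩ := surjective_chiLine hd hS hV l
    obtain ⟨D, rfl⟩ := surjective_chiLine hd hS hV m
    rw [dualInc_iff hK hd hS hV] at hxl hxm hyl hym
    rw [chiLine_eq_iff]
    exact h.vertex_eq_of_pencil_ne hK (hX x) (hX y)
      (fun he => hxy ((hchi x y).2 he.symm)) hxl hyl hxm hym
  · intro x C _
    obtain ⟨D, hxD, hD⟩ := h.exists_vertex_ne hK (hX x) C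
    exact ⟨D, (hI x D).2 hxD, fun he => hD ((chiLine_eq_iff D C).1 he)⟩
  · intro C D hr x y hxy hxC hxD hyC
    rw [hI] at hxC hxD hyC ⊢
    obtain ⟨c, hc⟩ := (hnear x y).1 hxy.symm
    have hcC := h.mem_vertex_of_mem_pencil hK (hX x) hc
      (sub_mem hyC (Submodule.smul_mem _ c hxC))
    rw [(chiLine_eq_iff C D).1 hr] at hcC
    have := add_mem (h.vertex_le D hcC) (Submodule.smul_mem _ c hxD)
    rwa [sub_add_cancel] at this
  · intro x C hxC
    -- Shifting x by a nonzero vertex vector gives the near point. Were it x again, either this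
    -- vector would vanish or x would lie in the vertex.
    obtain ⟨y, hy, hy0⟩ := (Submodule.ne_bot_iff _).1 (h.vertex_ne_bot C)
    have hxC' := (hI x C).1 hxC
    obtain ⟨z, hz, c, hc, hzc⟩ := exists_inc_of_mem (h.add_mem_set C _ (hX x) hxC' y hy)
      (add_mem hxC' (h.vertex_le C hy))
    have hsub : (z : ℙ K E).rep - c • (x : ℙ K E).rep = c • y := by
      rw [hzc, smul_add, add_sub_cancel_left]
    refine ⟨z, ?_, hz, ?_⟩
    · rintro rfl
      have hcy := Submodule.smul_mem _ c hy
      rw [← hsub] at hcy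
      rw [show (z : ℙ K E).rep - c • (z : ℙ K E).rep = (1 - c) • (z : ℙ K E).rep by module]
        at hcy hsub
      by_cases h1 : 1 - c = 0
      · rw [h1, zero_smul] at hsub
        exact smul_ne_zero hc hy0 hsub.symm
      · exact h.notMem_vertex _ (hX z) C ((Submodule.smul_mem_iff _ h1).1 hcy)
    · exact (hnear x z).2 ⟨c, hsub ▸ Submodule.smul_mem _ c (IsTubeSystem.le_pencil hxC' hy)⟩

end TubicSet

end HVeronese

/-! ### The dual plane and the Hjelmslev epimorphism -/

namespace IsHjelmslevSystem

variable {P T A B : Type*} {I : P → T → Prop} {q : P → A} {r : T → B} {J : A → B → Prop}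

theorem inc_of_mem (H : IsHjelmslevSystem I q r J) {x : P} {C : T} (h : I x C) :
    J (q x) (r C) :=
  (H.inc_iff x C).2 ⟨C, h, rfl⟩

/-- Choose y over p and a tube F through y whose vertex differs from that of C. A common point of C
and F lies over p, since otherwise two lines of the dual plane would share two points. -/
theorem inc_iff_exists (H : IsHjelmslevSystem I q r J) (C : T) (p : A) :
    J p (r C) ↔ ∃ x, I x C ∧ q x = p := by
  constructor
  · intro h
    obtain ⟨y, rfl⟩ := H.surjective_points p
    obtain ⟨D, hyD, hD⟩ := (H.inc_iff y C).1 h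
    obtain ⟨F, hyF, hF⟩ := H.exists_vertex_ne y D hyD
    obtain ⟨x, hxC, hxF⟩ := H.meet C F
    refine ⟨x, hxC, ?_⟩
    by_contra hne
    exact hF (hD ▸ (H.line_eq x y hne _ _ (H.inc_of_mem hxF) (H.inc_of_mem hxC)
      (H.inc_of_mem hyF) h))
  · rintro ⟨x, hx, rfl⟩
    exact H.inc_of_mem hx

/-- If x and y have the same image, another tube through x with the vertex of C also contains y. -/
theorem unique_tube_iff (H : IsHjelmslevSystem I q r J) (x y : P) :
    (∃! C, I x C ∧ I y C) ↔ q x ≠ q y := by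
  constructor
  · rintro ⟨C, ⟨hx, hy⟩, hC⟩ hxy
    obtain ⟨D, hDC, hxD, hD⟩ := H.exists_other x C hx
    exact hDC (hC D ⟨hxD, H.inc_of_inc C D hD.symm x y hxy hx hxD hy⟩)
  · intro hxy
    obtain ⟨C, hx, hy⟩ := H.joined x y
    refine ⟨C, ⟨hx, hy⟩, fun D ⟨hx', hy'⟩ => ?_⟩
    by_contra hDC
    exact hxy (H.point_eq D C hDC x y hx' hx hy' hy)

/-- Tubes with the same vertex share, along with x, a near point of x. -/
theorem unique_point_iff (H : IsHjelmslevSystem I q r J) (C D : T) :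
    (∃! x, I x C ∧ I x D) ↔ r C ≠ r D := by
  constructor
  · rintro ⟨x, ⟨hxC, hxD⟩, hx⟩ hr
    obtain ⟨y, hyx, hyC, hy⟩ := H.exists_near x C hxC
    exact hyx (hx y ⟨hyC, H.inc_of_inc C D hr x y hy.symm hxC hxD hyC⟩)
  · intro hr
    obtain ⟨x, hxC, hxD⟩ := H.meet C D
    exact ⟨x, ⟨hxC, hxD⟩, fun y hy => H.eq_of_vertex_ne C D hr y x hy.1 hy.2 hxC hxD⟩

theorem exists_third (H : IsHjelmslevSystem I q r J) (C : T) (p p' : A) :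
    ∃ x, I x C ∧ q x ≠ p ∧ q x ≠ p' := by
  obtain ⟨a, b, c, ha, hb, hc, hab, hac, hbc⟩ := H.exists_three C
  by_cases hap : q a = p
  · by_cases hbp : q b = p'
    · exact ⟨c, hc, fun h => hac (hap.trans h.symm), fun h => hbc (hbp.trans h.symm)⟩
    · exact ⟨b, hb, fun h => hab (hap.trans h.symm), hbp⟩
  · by_cases hap' : q a = p'
    · by_cases hbp : q b = p
      · exact ⟨c, hc, fun h => hbc (hbp.trans h.symm), fun h => hac (hap'.trans h.symm)⟩
      · exact ⟨b, hb, hbp, fun h => hab (hap'.trans h.symm)⟩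
    · exact ⟨a, ha, hap, hap'⟩

theorem isIncidenceEpimorphism (H : IsHjelmslevSystem I q r J) :
    IsIncidenceEpimorphism I J q r :=
  ⟨fun _ _ h => H.inc_of_mem h, H.surjective_points, H.surjective_lines⟩

theorem exists_line (H : IsHjelmslevSystem I q r J) (p p' : A) : ∃ l, J p l ∧ J p' l := by
  obtain ⟨x, rfl⟩ := H.surjective_points p
  obtain ⟨y, rfl⟩ := H.surjective_points p'
  obtain ⟨C, hx, hy⟩ := H.joined x y
  exact ⟨r C, H.inc_of_mem hx, H.inc_of_mem hy⟩

theorem exists_point (H : IsHjelmslevSystem I q r J) (l l' : B) : ∃ p, J p l ∧ J p l' := by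
  obtain ⟨C, rfl⟩ := H.surjective_lines l
  obtain ⟨D, rfl⟩ := H.surjective_lines l'
  obtain ⟨x, hx, hy⟩ := H.meet C D
  exact ⟨q x, H.inc_of_mem hx, H.inc_of_mem hy⟩

theorem eq_of_inc (H : IsHjelmslevSystem I q r J) {p p' : A} (hne : p ≠ p') {l l' : B}
    (h₁ : J p l) (h₂ : J p l') (h₃ : J p' l) (h₄ : J p' l') : l = l' := by
  obtain ⟨x, rfl⟩ := H.surjective_points p
  obtain ⟨y, rfl⟩ := H.surjective_points p'
  exact H.line_eq x y hne _ _ h₁ h₂ h₃ h₄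

theorem exists_point_third (H : IsHjelmslevSystem I q r J) (l : B) (p p' : A) :
    ∃ s, J s l ∧ s ≠ p ∧ s ≠ p' := by
  obtain ⟨C, rfl⟩ := H.surjective_lines l
  obtain ⟨x, hx, h⟩ := H.exists_third C p p'
  exact ⟨q x, H.inc_of_mem hx, h⟩

theorem exists_line_ne (H : IsHjelmslevSystem I q r J) (p : A) (l : B) : ∃ m, J p m ∧ m ≠ l := by
  obtain ⟨x, rfl⟩ := H.surjective_points p
  obtain ⟨C, hx, -⟩ := H.joined x x
  by_cases hC : r C = l
  · obtain ⟨D, hxD, hD⟩ := H.exists_vertex_ne x C hx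
    exact ⟨r D, H.inc_of_mem hxD, hC ▸ hD⟩
  · exact ⟨r C, H.inc_of_mem hx, hC⟩

theorem exists_point_notMem (H : IsHjelmslevSystem I q r J) (l : B) : ∃ p, ¬ J p l := by
  obtain ⟨C, -⟩ := H.surjective_lines l
  obtain ⟨a, -⟩ := H.exists_three C
  obtain ⟨m, ham, hm⟩ := H.exists_line_ne (q a) l
  obtain ⟨b, hb, hba, -⟩ := H.exists_point_third m (q a) (q a)
  by_cases hal : J (q a) l
  · exact ⟨b, fun hbl => hm (H.eq_of_inc hba hb hbl ham hal)⟩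
  · exact ⟨q a, hal⟩

theorem exists_line_notMem (H : IsHjelmslevSystem I q r J) (p : A) : ∃ l, ¬ J p l := by
  obtain ⟨C⟩ := H.nonempty
  obtain ⟨l, hpl, -⟩ := H.exists_line_ne p (r C)
  obtain ⟨b, hb, hbp, -⟩ := H.exists_point_third l p p
  obtain ⟨m, hbm, hm⟩ := H.exists_line_ne b l
  exact ⟨m, fun hpm => hm (H.eq_of_inc hbp hbm hb hpm hpl)⟩

/-- In a triangle a, c, e, take a third point b on ac and a third point s on ce. The points s, a, b
and the lines ce, ac, ae form the configuration. -/
theorem exists_config (H : IsHjelmslevSystem I q r J) : ∃ (p₁ p₂ p₃ : A) (l₁ l₂ l₃ : B),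
    ¬ J p₁ l₂ ∧ ¬ J p₁ l₃ ∧ ¬ J p₂ l₁ ∧ J p₂ l₂ ∧ J p₂ l₃ ∧ ¬ J p₃ l₁ ∧ J p₃ l₂ ∧ ¬ J p₃ l₃ := by
  obtain ⟨C⟩ := H.nonempty
  obtain ⟨x, -⟩ := H.exists_three C
  set a := q x
  obtain ⟨l, hal, -⟩ := H.exists_line_ne a (r C)
  obtain ⟨m, ham, hml⟩ := H.exists_line_ne a l
  obtain ⟨b, hbl, hba, -⟩ := H.exists_point_third l a a
  obtain ⟨c, hcl, hca, hcb⟩ := H.exists_point_third l a b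
  obtain ⟨e, hem, hea, -⟩ := H.exists_point_third m a a
  obtain ⟨k, hck, hek⟩ := H.exists_line c e
  have hel : ¬ J e l := fun hel => hml (H.eq_of_inc hea hem hel ham hal)
  have hcm : ¬ J c m := fun hcm => hml (H.eq_of_inc hca hcm hcl ham hal)
  have hbm : ¬ J b m := fun hbm => hml (H.eq_of_inc hba hbm hbl ham hal)
  have hkl : k ≠ l := fun h => hel (h ▸ hek)
  have hkm : k ≠ m := fun h => hcm (h ▸ hck)
  obtain ⟨s, hsk, hsc, hse⟩ := H.exists_point_third k c e
  exact ⟨s, a, b, k, l, m, fun h => hkl (H.eq_of_inc hsc hsk h hck hcl),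
    fun h => hkm (H.eq_of_inc hse hsk h hek hem), fun h => hkl (H.eq_of_inc hca hck hcl h hal),
    hal, ham, fun h => hkl (H.eq_of_inc hcb hck hcl h hbl), hbl, hbm⟩

theorem isProjectivePlane (H : IsHjelmslevSystem I q r J) : IsProjectivePlane J := by
  choose line hline using H.exists_line
  choose point hpoint using H.exists_point
  refine ⟨@Configuration.ProjectivePlane.mk A B ⟨fun l p => J p l⟩
    (@Configuration.HasPoints.mk A B ⟨fun l p => J p l⟩
      (@Configuration.Nondegenerate.mk A B ⟨fun l p => J p l⟩ H.exists_point_notMem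
        H.exists_line_notMem fun {p₁ p₂ l₁ l₂} h₁ h₂ h₃ h₄ => ?_)
      (fun {l l'} _ => point l l') fun {l l'} _ => hpoint l l')
    (fun {p p'} _ => line p p') (fun {p p'} _ => hline p p') H.exists_config⟩
  by_cases hp : p₁ = p₂
  · exact Or.inl hp
  · exact Or.inr (H.eq_of_inc hp h₁ h₃ h₂ h₄)

theorem isProjectiveHjelmslevPlaneLevelTwo {P A : Type u} {T B : Type w} {I : P → T → Prop}
    {q : P → A} {r : T → B} {J : A → B → Prop} (H : IsHjelmslevSystem I q r J) :
    IsProjectiveHjelmslevPlaneLevelTwo I := by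
  refine ⟨H.joined, H.meet, A, B, J, q, r, H.isProjectivePlane, H.isIncidenceEpimorphism, ?_, ?_⟩
  · intro x y
    rw [H.unique_tube_iff, not_not]
  · intro C D
    rw [H.unique_point_iff, not_not]

end IsHjelmslevSystem

/-! ### The affine planes (Hj3) and (Hj4) -/

namespace HVeronese

namespace TubicSet

variable {K E : Type*} [Field K] [AddCommGroup E] [Module K E] {d v : ℕ∞} {S : TubicSet K E d v}

theorem mem_X_of_mem_tube {x : ℙ K E} {C : S.Tube} (hx : x ∈ C.1) : x ∈ S.X := by
  rw [S.coe_eq_inter_tubicSpace C] at hx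
  exact hx.1

theorem pointFibre_inter_subset (H : IsHjelmslevSystem S.Inc S.chi S.chiLine S.DualInc)
    {p : S.DualPoint} {C D : S.Tube} (hCD : S.chiLine C = S.chiLine D) {x : ℙ K E}
    (hx : x ∈ S.pointFibre p) (hxC : x ∈ C.1) (hxD : x ∈ D.1) :
    S.pointFibre p ∩ C.1 ⊆ S.pointFibre p ∩ D.1 := by
  obtain ⟨hxX, hxp⟩ := hx
  rintro y ⟨⟨hyX, hyp⟩, hyC⟩
  exact ⟨⟨hyX, hyp⟩, H.inc_of_inc C D hCD ⟨x, hxX⟩ ⟨y, hyX⟩ (hxp.trans hyp.symm) hxC hxD hyC⟩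

theorem pointFibre_inter_eq (H : IsHjelmslevSystem S.Inc S.chi S.chiLine S.DualInc)
    {p : S.DualPoint} {C D : S.Tube} (hCD : S.chiLine C = S.chiLine D) {x : ℙ K E}
    (hx : x ∈ S.pointFibre p) (hxC : x ∈ C.1) (hxD : x ∈ D.1) :
    S.pointFibre p ∩ C.1 = S.pointFibre p ∩ D.1 :=
  (pointFibre_inter_subset H hCD hx hxC hxD).antisymm
    (pointFibre_inter_subset H hCD.symm hx hxD hxC)

theorem chiLine_eq_of_mem (H : IsHjelmslevSystem S.Inc S.chi S.chiLine S.DualInc)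
    {x y : ℙ K E} (hxX : x ∈ S.X) (hyX : y ∈ S.X) (hxy : x ≠ y) {C D : S.Tube}
    (hxC : x ∈ C.1) (hxD : x ∈ D.1) (hyC : y ∈ C.1) (hyD : y ∈ D.1) :
    S.chiLine C = S.chiLine D := by
  by_contra hne
  exact hxy (congrArg Subtype.val
    (H.eq_of_vertex_ne C D hne ⟨x, hxX⟩ ⟨y, hyX⟩ hxC hxD hyC hyD))

theorem isAffinePlane_fibreInc (H : IsHjelmslevSystem S.Inc S.chi S.chiLine S.DualInc)
    (p : S.DualPoint) : IsAffinePlane (S.FibreInc p) := by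
  refine ⟨?_, ?_, ?_⟩
  · rintro ⟨x, hx⟩ ⟨y, hy⟩ hxy
    have hxy' : x ≠ y := fun h => hxy (Subtype.ext h)
    obtain ⟨C, hxC, hyC⟩ := H.joined ⟨x, hx.1⟩ ⟨y, hy.1⟩
    refine ⟨⟨S.pointFibre p ∩ C.1, ⟨x, hx, hxC⟩, C, rfl⟩, ⟨⟨hx, hxC⟩, ⟨hy, hyC⟩⟩, ?_⟩
    rintro ⟨_, _, D, rfl⟩ ⟨⟨_, hxD⟩, ⟨_, hyD⟩⟩
    exact Subtype.ext (pointFibre_inter_eq H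
      (chiLine_eq_of_mem H hx.1 hy.1 hxy' hxD hxC hyD hyC) hx hxD hxC)
  · rintro ⟨z, hz⟩ ⟨_, hne, C, rfl⟩ hzC
    obtain ⟨w, hw, hwC⟩ := hne
    have hzC' : z ∉ C.1 := fun h => hzC ⟨hz, h⟩
    have hwz : S.chi ⟨w, hw.1⟩ = S.chi ⟨z, hz.1⟩ := hw.2.trans hz.2.symm
    have hzJ : S.DualInc (S.chi ⟨z, hz.1⟩) (S.chiLine C) :=
      hwz ▸ H.inc_of_mem (x := ⟨w, hw.1⟩) hwC
    obtain ⟨D, hzD, hD⟩ := (H.inc_iff _ _).1 hzJ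
    refine ⟨⟨S.pointFibre p ∩ D.1, ⟨z, hz, hzD⟩, D, rfl⟩, ⟨⟨hz, hzD⟩, ?_⟩, ?_⟩
    · rintro ⟨u, hu⟩ ⟨⟨_, huC⟩, ⟨_, huD⟩⟩
      exact hzC' (pointFibre_inter_subset H hD hu huD huC ⟨hz, hzD⟩).2
    · rintro ⟨_, _, F, rfl⟩ ⟨⟨_, hzF⟩, hF⟩
      refine Subtype.ext (pointFibre_inter_eq H ?_ hz hzF hzD)
      -- If the vertices differ, F and C meet in a point whose image is on two distinct lines
      -- through the image of z. The point is then in the fibre, so the traces are not parallel.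
      by_contra hne
      rw [hD] at hne
      obtain ⟨u, huF, huC⟩ := H.meet F C
      have hu : S.chi u = S.chi ⟨z, hz.1⟩ := by
        by_contra huz
        exact hne (H.line_eq u ⟨z, hz.1⟩ huz _ _ (H.inc_of_mem huF) (H.inc_of_mem huC)
          (H.inc_of_mem hzF) hzJ)
      have hup : (u : ℙ K E) ∈ S.pointFibre p := ⟨u.2, hu.trans hz.2⟩
      exact hF ⟨u, hup⟩ ⟨⟨hup, huC⟩, ⟨hup, huF⟩⟩
  · obtain ⟨x, rfl⟩ := H.surjective_points p
    obtain ⟨C, hxC, -⟩ := H.joined x x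
    -- The triangle consists of x and a near point on each of two tubes with distinct vertices; a
    -- tube through all three would have both vertices.
    obtain ⟨D, hxD, hD⟩ := H.exists_vertex_ne x C hxC
    obtain ⟨y, hyx, hyC, hy⟩ := H.exists_near x C hxC
    obtain ⟨z, hzx, hzD, hz⟩ := H.exists_near x D hxD
    refine ⟨⟨x, x.2, rfl⟩, ⟨y, y.2, hy⟩, ⟨z, z.2, hz⟩, ?_⟩
    rintro ⟨_, _, F, rfl⟩ ⟨⟨_, hxF⟩, ⟨_, hyF⟩, ⟨_, hzF⟩⟩
    apply hD
    rw [chiLine_eq_of_mem H z.2 x.2 (fun h => hzx (Subtype.ext h)) hzD hzF hxD hxF]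
    exact chiLine_eq_of_mem H y.2 x.2 (fun h => hyx (Subtype.ext h)) hyF hyC hxF hxC

/-- The tubes in the inverse image of a line are those whose vertex is that line. -/
theorem subset_linePreimage_iff (H : IsHjelmslevSystem S.Inc S.chi S.chiLine S.DualInc)
    {l : S.DualLine} {C : S.Tube} : C.1 ⊆ S.linePreimage l ↔ S.chiLine C = l := by
  constructor
  · intro h
    obtain ⟨a, b, _, ha, hb, _, hab, _⟩ := H.exists_three C
    obtain ⟨_, hal⟩ := h ha
    obtain ⟨_, hbl⟩ := h hb
    exact H.line_eq a b hab _ _ (H.inc_of_mem ha) hal (H.inc_of_mem hb) hbl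
  · rintro rfl x hx
    exact ⟨mem_X_of_mem_tube hx, H.inc_of_mem (x := ⟨x, mem_X_of_mem_tube hx⟩) hx⟩

/-- If two distinct tubes share a point `z`, then every tube through `z` with the same vertex contains
their intersection. -/
theorem inter_subset (H : IsHjelmslevSystem S.Inc S.chi S.chiLine S.DualInc) {C D F : S.Tube}
    (hCD : C ≠ D) (hF : S.chiLine C = S.chiLine F) {z : ℙ K E} (hzC : z ∈ C.1)
    (hzD : z ∈ D.1) (hzF : z ∈ F.1) : C.1 ∩ D.1 ⊆ F.1 := by
  rintro x ⟨hxC, hxD⟩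
  have hzX := mem_X_of_mem_tube hzC
  have hxX := mem_X_of_mem_tube hxC
  exact H.inc_of_inc C F hF ⟨z, hzX⟩ ⟨x, hxX⟩
    (H.point_eq C D hCD ⟨z, hzX⟩ ⟨x, hxX⟩ hzC hzD hxC hxD) hzC hzF hxC

theorem inter_eq_inter (H : IsHjelmslevSystem S.Inc S.chi S.chiLine S.DualInc)
    {C C' D D' : S.Tube} (hC : C ≠ C') (hD : D ≠ D') (h₁ : S.chiLine C = S.chiLine C')
    (h₂ : S.chiLine D = S.chiLine D') (h₃ : S.chiLine C = S.chiLine D) {z : ℙ K E}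
    (hzC : z ∈ C.1) (hzC' : z ∈ C'.1) (hzD : z ∈ D.1) (hzD' : z ∈ D'.1) :
    C.1 ∩ C'.1 = D.1 ∩ D'.1 :=
  Set.Subset.antisymm
    (Set.subset_inter (inter_subset H hC h₃ hzC hzC' hzD)
      (inter_subset H hC (h₃.trans h₂) hzC hzC' hzD'))
    (Set.subset_inter (inter_subset H hD h₃.symm hzD hzD' hzC)
      (inter_subset H hD (h₃.symm.trans h₁) hzD hzD' hzC'))

/-- An intersection of two tubes lies over one point of l, and any of its points determines it.
Intersections over different points of l are joined by a tube, so parallelism means lying over the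
same point. -/
theorem isAffinePlane_nbhdInc (H : IsHjelmslevSystem S.Inc S.chi S.chiLine S.DualInc)
    (l : S.DualLine) : IsAffinePlane (S.NbhdInc l) := by
  have hl : ∀ C : S.NbhdTube l, S.chiLine C.1 = l := fun C => (subset_linePreimage_iff H).1 C.2
  have hr : ∀ C D : S.NbhdTube l, S.chiLine C.1 = S.chiLine D.1 := fun C D =>
    (hl C).trans (hl D).symm
  have hval : ∀ {C D : S.NbhdTube l}, C ≠ D → C.1 ≠ D.1 := fun h h' => h (Subtype.ext h')
  have hJ : ∀ (C : S.NbhdTube l) (x : S.X), S.Inc x C.1 → S.DualInc (S.chi x) l := fun C x hx =>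
    hl C ▸ H.inc_of_mem hx
  -- the tube joining two points with distinct images on `l`
  have hjoin : ∀ x y : S.X, S.chi x ≠ S.chi y → S.DualInc (S.chi x) l → S.DualInc (S.chi y) l →
      ∃ C : S.NbhdTube l, S.Inc x C.1 ∧ S.Inc y C.1 := by
    intro x y hxy hx hy
    obtain ⟨C, hxC, hyC⟩ := H.joined x y
    exact ⟨⟨C, (subset_linePreimage_iff H).2
      (H.line_eq x y hxy _ _ (H.inc_of_mem hxC) hx (H.inc_of_mem hyC) hy)⟩, hxC, hyC⟩
  have hother : ∀ (C : S.NbhdTube l) (x : S.X), S.Inc x C.1 →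
      ∃ D : S.NbhdTube l, C ≠ D ∧ S.Inc x D.1 := by
    intro C x hx
    obtain ⟨D, hDC, hxD, hD⟩ := H.exists_other x C.1 hx
    exact ⟨⟨D, (subset_linePreimage_iff H).2 (hD.trans (hl C))⟩,
      fun h => hDC (congrArg Subtype.val h).symm, hxD⟩
  refine ⟨?_, ?_, ?_⟩
  · intro C D hCD
    refine ⟨⟨C.1.1 ∩ D.1.1, C, D, hCD, rfl⟩, ⟨Set.inter_subset_left, Set.inter_subset_right⟩, ?_⟩
    rintro ⟨_, F, G, hFG, rfl⟩ ⟨hC, hD⟩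
    obtain ⟨z, hzF, hzG⟩ := H.meet F.1 G.1
    exact Subtype.ext (inter_eq_inter H (hval hFG) (hval hCD) (hr F G) (hr C D) (hr F C) hzF hzG
      (hC ⟨hzF, hzG⟩) (hD ⟨hzF, hzG⟩))
  · rintro C ⟨_, F, G, hFG, rfl⟩ hn
    obtain ⟨z, hzF, hzG⟩ := H.meet F.1 G.1
    have hzC : ¬ S.Inc z C.1 := fun hzC =>
      hn (inter_subset H (hval hFG) (hr F C) hzF hzG hzC)
    have hzl := hJ F z hzF
    -- The parallel through C is its intersection with another tube at a point w of C over the image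
    -- of z.
    obtain ⟨w, hwC, hwz⟩ := (H.inc_iff_exists C.1 (S.chi z)).1 (by rwa [hl C])
    obtain ⟨D, hCD, hwD⟩ := hother C w hwC
    refine ⟨⟨C.1.1 ∩ D.1.1, C, D, hCD, rfl⟩, ⟨Set.inter_subset_left, ?_⟩, ?_⟩
    · rintro Q ⟨hQ, hQ'⟩
      exact hzC (H.inc_of_inc Q.1 C.1 (hr Q C) w z hwz (hQ' ⟨hwC, hwD⟩) hwC (hQ ⟨hzF, hzG⟩))
    · rintro ⟨_, M, N, hMN, rfl⟩ ⟨hC, hpar⟩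
      obtain ⟨u, huM, huN⟩ := H.meet M.1 N.1
      have huC : S.Inc u C.1 := hC ⟨huM, huN⟩
      -- Otherwise the tube joining u and z would contain both intersections.
      have huz : S.chi u = S.chi z := by
        by_contra huz
        obtain ⟨Q, huQ, hzQ⟩ := hjoin u z huz (hJ M u huM) hzl
        exact hpar Q ⟨inter_subset H (hval hFG) (hr F Q) hzF hzG hzQ,
          inter_subset H (hval hMN) (hr M Q) huM huN huQ⟩
      have hwM : ∀ Q : S.NbhdTube l, S.Inc u Q.1 → S.Inc w Q.1 := fun Q huQ =>
        H.inc_of_inc C.1 Q.1 (hr C Q) u w (huz.trans hwz.symm) huC huQ hwC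
      exact Subtype.ext (inter_eq_inter H (hval hMN) (hval hCD) (hr M N) (hr C D) (hr M C)
        (hwM M huM) (hwM N huN) hwC hwD)
  · obtain ⟨C, hC⟩ := H.surjective_lines l
    let C : S.NbhdTube l := ⟨C, (subset_linePreimage_iff H).2 hC⟩
    obtain ⟨x, _, _, hxC, -⟩ := H.exists_three C.1
    obtain ⟨D, hCD, hxD⟩ := hother C x hxC
    obtain ⟨c, hcC, hcx, -⟩ := H.exists_third C.1 (S.chi x) (S.chi x)
    obtain ⟨e, heD, hex, hec⟩ := H.exists_third D.1 (S.chi x) (S.chi c)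
    obtain ⟨F, hcF, heF⟩ := hjoin c e hec.symm (hJ C c hcC) (hJ D e heD)
    -- A tube F through x would share points with distinct images with both C and D, hence equal
    -- both.
    have hxF : ¬ S.Inc x F.1 := by
      intro hxF
      have hFC : F.1 = C.1 := by
        by_contra h
        exact hcx (H.point_eq F.1 C.1 h c x hcF hcC hxF hxC)
      have hFD : F.1 = D.1 := by
        by_contra h
        exact hex (H.point_eq F.1 D.1 h e x heF heD hxF hxD)
      exact hval hCD (hFC.symm.trans hFD)
    refine ⟨C, D, F, ?_⟩
    rintro ⟨_, M, N, _, rfl⟩ ⟨hC', hD', hF'⟩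
    obtain ⟨z, hzM, hzN⟩ := H.meet M.1 N.1
    exact hxF (inter_subset H (hval hCD) (hr C F) (hC' ⟨hzM, hzN⟩) (hD' ⟨hzM, hzN⟩)
      (hF' ⟨hzM, hzN⟩) ⟨hxC, hxD⟩)

end TubicSet

end HVeronese

theorem proposition8 {K E : Type*} [Field K] [AddCommGroup E] [Module K E]
    (hK : 2 < ENat.card K) (d v : ℕ∞) (hd : 1 ≤ d)
    (S : HVeronese.TubicSet K E d v) (hS : S.IsHjelmslevean) (hV : S.VertexReduced) :
    -- points and tubes form a projective Hjelmslev plane of level 2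
    IsProjectiveHjelmslevPlaneLevelTwo S.Inc ∧
    -- `chi` is an epimorphism onto the dual plane of vertices, a projective plane
    IsProjectivePlane S.DualInc ∧
    IsIncidenceEpimorphism S.Inc S.DualInc S.chi S.chiLine ∧
    -- the image of a tube under `chi` is the full point row of the line `chiLine C`
    (∀ (C : S.Tube) (p : S.DualPoint),
      S.DualInc p (S.chiLine C) ↔ ∃ x : S.X, S.Inc x C ∧ S.chi x = p) ∧
    -- (Hj1)
    (∀ x x' : S.X, (∃ C : S.Tube, S.Inc x C ∧ S.Inc x' C) ∧
      ((∃! C : S.Tube, S.Inc x C ∧ S.Inc x' C) ↔ S.chi x ≠ S.chi x')) ∧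
    -- (Hj2)
    (∀ C C' : S.Tube, (∃ x : S.X, S.Inc x C ∧ S.Inc x C') ∧
      ((∃! x : S.X, S.Inc x C ∧ S.Inc x C') ↔ S.chiLine C ≠ S.chiLine C')) ∧
    -- (Hj3)
    (∀ p : S.DualPoint, IsAffinePlane (S.FibreInc p)) ∧
    -- (Hj4)
    (∀ l : S.DualLine, IsAffinePlane (S.NbhdInc l)) := by
  have hk := HVeronese.exists_ne_zero_ne_one hK
  have H := HVeronese.TubicSet.isHjelmslevSystem hk hd hS hV
  exact ⟨H.isProjectiveHjelmslevPlaneLevelTwo, H.isProjectivePlane, H.isIncidenceEpimorphism,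
    fun C p => H.inc_iff_exists C p, fun x y => ⟨H.joined x y, H.unique_tube_iff x y⟩,
    fun C D => ⟨H.meet C D, H.unique_point_iff C D⟩,
    HVeronese.TubicSet.isAffinePlane_fibreInc H, HVeronese.TubicSet.isAffinePlane_nbhdInc H⟩
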